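/- **Definitions.** Let $n\ge 0$ be an integer. $\Psi_n$ is the set of functions $\varphi:[0,\infty)\to\mathbb R$ such that $\mathbf t\mapsto\varphi(\mathbf t'\mathbf t)$, $\mathbf t\in\mathbb R^n$, is the characteristic function of some probability measure on $\mathbb R^n$. For $\boldsymbol\mu\in\mathbb R^n$, a symmetric positive semidefinite $n\times n$ matrix $\boldsymbol\Sigma$ and $\varphi\in\Psi_n$, write $\mathbf X\sim E_n(\boldsymbol\mu,\boldsymbol\Sigma,\varphi)$ if the random vector $\mathbf X$ has characteristic function $\mathbf t\mapsto e^{i\mathbf t'\boldsymbol\mu}\varphi(\mathbf t'\boldsymbol\Sigma\mathbf t)$. An $n\times n$ real matrix $\mathbf A$ is *copositive* if $\mathbf x'\mathbf A\mathbf x\ge 0$ for all $\mathbf x\in\mathbb R^n$ with nonnegative entries, and *completely positive* if $\mathbf A=\mathbf B'\mathbf B$ for some $m\times n$ matrix $\mathbf B$ with nonnegative entries (for some $m$). For random vectors $\mathbf X,\mathbf Y$ in $\mathbb R^n$, write $\mathbf X\le_{cp}\mathbf Y$ (respectively $\mathbf X\le_{cop}\mathbf Y$) if $E[f(\mathbf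 X)]\le E[f(\mathbf Y)]$ for every twice continuously differentiable $f:\mathbb R^n\to\mathbb R$ whose Hessian matrix $\mathbf H_f(\mathbf x)$ is completely positive (respectively copositive) at every $\mathbf x\in\mathbb R^n$ and for which $f(\mathbf X)$ and $f(\mathbf Y)$ are integrable. **Theorem 3.11.** Let $\mathbf X\sim E_n(\boldsymbol\mu^x,\boldsymbol\Sigma^x,\varphi)$ and $\mathbf Y\sim E_n(\boldsymbol\mu^y,\boldsymbol\Sigma^y,\varphi)$, where $\varphi$ is not identically $1$ on $[0,\infty)$, and assume that $E\|\mathbf X\|^2<\infty$ and $E\|\mathbf Y\|^2<\infty$. Then 1. $\mathbf X\le_{cp}\mathbf Y$ if and only if $\boldsymbol\mu^x=\boldsymbol\mu^y$ and $\boldsymbol\Sigma^y-\boldsymbol\Sigma^x$ is copositive; 2. $\mathbf X\le_{cop}\mathbf Y$ if and only if $\boldsymbol\mu^x=\boldsymbol\mu^y$ and $\boldsymbol\Sigma^y-\boldsymbol\Sigma^x$ is completely positive. -/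

import Mathlib

open MeasureTheory
open scoped Matrix

namespace HessianOrder

/-- `n`-dimensional Euclidean space. -/
abbrev Vec (n : ℕ) : Type := EuclideanSpace ℝ (Fin n)

/-- The class `Ψ_n` of `n`-dimensional characteristic generators: the functions `φ` (only the
values on `[0, ∞)` matter) such that `t ↦ φ (t' t)` is the characteristic function of some
probability measure on `ℝⁿ`. In particular `φ 0 = 1`. -/
def charGenerators (n : ℕ) : Set (ℝ → ℝ) :=
  {φ | ∃ ν : Measure (Vec n), IsProbabilityMeasure ν ∧
    ∀ t : Vec n, charFun ν t = ((φ (t.ofLp ⬝ᵥ t.ofLp) : ℝ) : ℂ)}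

/-- `X ∼ E_n(μ, S, φ)` under the probability `P`: the dispersion matrix `S` is symmetric positive
semidefinite, `φ ∈ Ψ_n`, and the characteristic function of `X` is
`t ↦ exp (i t'μ) φ (t' S t)`. -/
structure IsElliptical {Ω : Type*} [MeasurableSpace Ω] {n : ℕ} (P : Measure Ω) (X : Ω → Vec n)
    (μ : Vec n) (S : Matrix (Fin n) (Fin n) ℝ) (φ : ℝ → ℝ) : Prop where
  aemeasurable : AEMeasurable X P
  posSemidef : S.PosSemidef
  generator : φ ∈ charGenerators n
  charFun_eq : ∀ t : Vec n, charFun (P.map X) t =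
    Complex.exp (Complex.I * ((t.ofLp ⬝ᵥ μ.ofLp : ℝ) : ℂ)) *
      ((φ (t.ofLp ⬝ᵥ (S *ᵥ t.ofLp)) : ℝ) : ℂ)

/-- The cone of copositive matrices: `x' A x ≥ 0` for all `x ≥ 0`. -/
def copositiveCone (n : ℕ) : Set (Matrix (Fin n) (Fin n) ℝ) :=
  {A | ∀ x : Fin n → ℝ, (∀ i, 0 ≤ x i) → 0 ≤ x ⬝ᵥ (A *ᵥ x)}

/-- The cone of completely positive matrices: `A = B' B` for an entrywise nonnegative `m × n`
matrix `B`, for some `m`. -/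
def completelyPositiveCone (n : ℕ) : Set (Matrix (Fin n) (Fin n) ℝ) :=
  {A | ∃ (m : ℕ) (B : Matrix (Fin m) (Fin n) ℝ), (∀ i j, 0 ≤ B i j) ∧ A = Bᵀ * B}

/-- The partial derivative `∂f/∂xᵢ` at `x`. -/
noncomputable def partialDeriv {n : ℕ} (i : Fin n) (f : Vec n → ℝ) (x : Vec n) : ℝ :=
  fderiv ℝ f x (EuclideanSpace.single i 1)

/-- The Hessian matrix `(∂²f/∂xᵢ∂xⱼ (x))` of `f` at `x`. -/
noncomputable def hessian {n : ℕ} (f : Vec n → ℝ) (x : Vec n) : Matrix (Fin n) (Fin n) ℝ :=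
  Matrix.of fun i j => partialDeriv i (partialDeriv j f) x

/-- The Hessian order generated by a set `C` of matrices: `E[f(X)] ≤ E[f(Y)]` for every twice
continuously differentiable `f : ℝⁿ → ℝ` whose Hessian lies in `C` at every point and for which
both expectations exist. -/
def HessianLE {Ω Ω' : Type*} [MeasurableSpace Ω] [MeasurableSpace Ω'] {n : ℕ}
    (C : Set (Matrix (Fin n) (Fin n) ℝ)) (P : Measure Ω) (X : Ω → Vec n)
    (Q : Measure Ω') (Y : Ω' → Vec n) : Prop :=
  ∀ f : Vec n → ℝ, ContDiff ℝ 2 f → (∀ x, hessian f x ∈ C) →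
    Integrable (fun ω => f (X ω)) P → Integrable (fun ω => f (Y ω)) Q →
    ∫ ω, f (X ω) ∂P ≤ ∫ ω, f (Y ω) ∂Q

/-- `X ≤_cp Y`. -/
def CpLE {Ω Ω' : Type*} [MeasurableSpace Ω] [MeasurableSpace Ω'] {n : ℕ}
    (P : Measure Ω) (X : Ω → Vec n) (Q : Measure Ω') (Y : Ω' → Vec n) : Prop :=
  HessianLE (completelyPositiveCone n) P X Q Y

/-- `X ≤_cop Y`. -/
def CopLE {Ω Ω' : Type*} [MeasurableSpace Ω] [MeasurableSpace Ω'] {n : ℕ}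
    (P : Measure Ω) (X : Ω → Vec n) (Q : Measure Ω') (Y : Ω' → Vec n) : Prop :=
  HessianLE (copositiveCone n) P X Q Y

end HessianOrder

namespace HessianOrder

/-! Both laws are affine images `μ + A x` of one rotation invariant probability `ν`, with `A * Aᵀ`
the dispersion matrix. The theorem reduces to the pairing `∑ M a b * (Sy - Sx) a b` of matrices, for
which the completely positive and the copositive cones are dual to each other.

Necessity: the linear functions `±y i` have zero Hessian, so the order forces equal means. The
covariance of `ν` is `c` times the identity, with `c > 0` unless `φ` is identically one on `[0, ∞)`,
so testing the order on a quadratic form with Hessian `M` says that `M` pairs nonnegatively with `Sy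
- Sx` (`HessianLE.sum_nonneg`). Rank one matrices `x x'` then give copositivity. Conversely, pairing
with all symmetric copositive matrices detects complete positivity by Hahn-Banach separation, since
the completely positive cone is closed.

Sufficiency: a congruence diagonalizes `Sx` and `Sy` simultaneously, so the segment of dispersion
matrices joining them is realized by maps `μ + A D(l) x` with `D(l)` diagonal. The derivative in `l`
of the expectation of `f` is the `ν`-integral of `F(x) · x`, for a vector field `F` whose divergence
is half the pairing of the Hessian of `f` with `Sy - Sx`, hence nonnegative. For a radial density
`p` one has `p(x) x = -∇G` with `G ≥ 0` compactly supported, and integration by parts turns the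
integral into that of `G div F`. A general `ν` is truncated to balls and smoothed, so integrability
of `f` is needed only at the two ends of the path. -/

/-! ### Simultaneous diagonalization by congruence -/

theorem exists_orthogonal_diagonal {n : ℕ} {S : Matrix (Fin n) (Fin n) ℝ} (hS : S.PosSemidef) :
    ∃ (U : Matrix (Fin n) (Fin n) ℝ) (d : Fin n → ℝ), U * Uᵀ = 1 ∧ Uᵀ * U = 1 ∧ (∀ i, 0 ≤ d i) ∧
      S = U * Matrix.diagonal d * Uᵀ := by
  refine ⟨hS.1.eigenvectorUnitary, hS.1.eigenvalues, ?_, ?_, hS.eigenvalues_nonneg, ?_⟩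
  · have := Unitary.coe_mul_star_self hS.1.eigenvectorUnitary
    rwa [Unitary.coe_star, Matrix.star_eq_conjTranspose, Matrix.conjTranspose_eq_transpose_of_trivial] at this
  · have := Unitary.coe_star_mul_self hS.1.eigenvectorUnitary
    rwa [Matrix.star_eq_conjTranspose, Matrix.conjTranspose_eq_transpose_of_trivial] at this
  · have := hS.1.spectral_theorem
    rw [Unitary.conjStarAlgAut_apply, Matrix.star_eq_conjTranspose,
      Matrix.conjTranspose_eq_transpose_of_trivial] at this
    simpa [Function.comp_def] using this

/-- Two positive semidefinite matrices are simultaneously diagonalizable by congruence. -/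
theorem exists_simultaneous_diagonal {n : ℕ} {S T : Matrix (Fin n) (Fin n) ℝ}
    (hS : S.PosSemidef) (hT : T.PosSemidef) :
    ∃ (A : Matrix (Fin n) (Fin n) ℝ) (κ : Fin n → ℝ), (∀ i, 0 ≤ κ i) ∧ (∀ i, κ i ≤ 1) ∧
      S = A * Matrix.diagonal κ * Aᵀ ∧ T = A * Matrix.diagonal (fun i => 1 - κ i) * Aᵀ := by
  obtain ⟨U, s, hU, hU', hs, hST⟩ := exists_orthogonal_diagonal (hS.add hT)
  set r : Fin n → ℝ := fun i => √(s i) with hr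
  have hrr : ∀ i, r i * r i = s i := fun i => Real.mul_self_sqrt (hs i)
  set J := U * Matrix.diagonal r with hJ
  -- As `0⁻¹ = 0`, `G` is the pseudo-inverse of `J`, and `J * G` is the orthogonal projection onto
  -- the range of `S + T`, which may be singular.
  set G := Matrix.diagonal (fun i => (r i)⁻¹) * Uᵀ with hG
  have hJJ : J * Jᵀ = S + T := by
    rw [hST, hJ, Matrix.transpose_mul, Matrix.diagonal_transpose, ← Matrix.mul_assoc,
      Matrix.mul_assoc U, Matrix.diagonal_mul_diagonal]
    simp only [hrr]
  -- The kernel of `S + T` lies in that of `S`: two nonnegative quadratic forms with sum zero at `w`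
  -- both vanish there.
  have hSP : S * (1 - J * G) = 0 := by
    have hST0 : (S + T) * (1 - J * G) = 0 := by
      have : (S + T) * (J * G) = S + T := by
        have : U * Matrix.diagonal s * Uᵀ * (U * Matrix.diagonal r *
            (Matrix.diagonal (fun i => (r i)⁻¹) * Uᵀ)) =
            U * (Matrix.diagonal s * (Uᵀ * U) * (Matrix.diagonal r *
            Matrix.diagonal (fun i => (r i)⁻¹))) * Uᵀ := by
          simp only [Matrix.mul_assoc]
        rw [hST, hJ, hG, this, hU', Matrix.mul_one, Matrix.diagonal_mul_diagonal,
          Matrix.diagonal_mul_diagonal]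
        congr 3
        funext i
        by_cases h : r i = 0
        · simp [← hrr, h]
        · field_simp
      rw [Matrix.mul_sub, this, Matrix.mul_one, sub_self]
    refine Matrix.ext_of_mulVec_single fun j => ?_
    rw [← Matrix.mulVec_mulVec, Matrix.zero_mulVec]
    set w := (1 - J * G) *ᵥ Pi.single j 1
    have h0 : (S + T) *ᵥ w = 0 := by
      rw [Matrix.mulVec_mulVec, hST0, Matrix.zero_mulVec]
    have h1 : star w ⬝ᵥ (S *ᵥ w) + star w ⬝ᵥ (T *ᵥ w) = 0 := by
      rw [← dotProduct_add, ← Matrix.add_mulVec, h0, dotProduct_zero]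
    have h2 := hS.dotProduct_mulVec_nonneg w
    have h3 := hT.dotProduct_mulVec_nonneg w
    exact (hS.dotProduct_mulVec_zero_iff w).1 (by linarith)
  have hSJ : S * (J * G) = S := by
    rw [Matrix.mul_sub, Matrix.mul_one, sub_eq_zero] at hSP
    exact hSP.symm
  have hSt : Sᵀ = S := by
    have := hS.1
    rwa [Matrix.IsHermitian, Matrix.conjTranspose_eq_transpose_of_trivial] at this
  have hJGt : (J * G)ᵀ = J * G := by
    rw [hJ, hG]
    simp only [Matrix.transpose_mul, Matrix.diagonal_transpose, Matrix.transpose_transpose,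
      Matrix.mul_assoc]
    rw [← Matrix.mul_assoc (Matrix.diagonal r), ← Matrix.mul_assoc (Matrix.diagonal _),
      Matrix.diagonal_mul_diagonal, Matrix.diagonal_mul_diagonal]
    simp only [mul_comm]
  have hJS : J * G * S = S := by
    have := congrArg Matrix.transpose hSJ
    rwa [Matrix.transpose_mul, hSt, hJGt] at this
  have hK : (G * S * Gᵀ).PosSemidef := by
    simpa [Matrix.conjTranspose_eq_transpose_of_trivial] using hS.mul_mul_conjTranspose_same G
  have hL : (G * T * Gᵀ).PosSemidef := by
    simpa [Matrix.conjTranspose_eq_transpose_of_trivial] using hT.mul_mul_conjTranspose_same G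
  obtain ⟨V, κ, hV, hV', hκ, hKV⟩ := exists_orthogonal_diagonal hK
  have hGG : G * (S + T) * Gᵀ = Matrix.diagonal fun i => if r i = 0 then 0 else 1 := by
    rw [hST, hG, Matrix.transpose_mul, Matrix.diagonal_transpose, Matrix.transpose_transpose]
    calc _ = Matrix.diagonal (fun i => (r i)⁻¹) * ((Uᵀ * U) * Matrix.diagonal s * (Uᵀ * U)) *
          Matrix.diagonal (fun i => (r i)⁻¹) := by simp only [Matrix.mul_assoc]
      _ = _ := by
        rw [hU', Matrix.mul_one, Matrix.one_mul, Matrix.diagonal_mul_diagonal,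
          Matrix.diagonal_mul_diagonal]
        congr 1
        funext i
        split_ifs with h
        · simp [h]
        · rw [← hrr]
          field_simp
  -- `G * (S + T) * Gᵀ` is the identity only where `r` is nonzero; the rest of the identity is added
  -- as a positive semidefinite diagonal.
  have h1K : (1 - G * S * Gᵀ).PosSemidef := by
    have : 1 - G * S * Gᵀ = G * T * Gᵀ + Matrix.diagonal fun i => if r i = 0 then 1 else 0 := by
      have h2 : (1 : Matrix (Fin n) (Fin n) ℝ) = (Matrix.diagonal fun i => if r i = 0 then 0 else 1)
          + Matrix.diagonal fun i => if r i = 0 then 1 else 0 := by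
        rw [Matrix.diagonal_add, ← Matrix.diagonal_one]
        congr 1
        funext i
        split_ifs <;> simp
      nth_rewrite 1 [h2]
      rw [← hGG, Matrix.mul_add, Matrix.add_mul]
      abel
    rw [this]
    refine hL.add (Matrix.PosSemidef.diagonal fun i => ?_)
    simp only [Pi.zero_apply]
    split_ifs <;> simp
  have hAA : J * V * (J * V)ᵀ = S + T := by
    rw [Matrix.transpose_mul, ← hJJ]
    calc _ = J * (V * Vᵀ) * Jᵀ := by simp only [Matrix.mul_assoc]
      _ = _ := by rw [hV, Matrix.mul_one]
  have hAS : S = J * V * Matrix.diagonal κ * (J * V)ᵀ := by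
    calc S = J * G * S * (J * G)ᵀ := by rw [hJS, hJGt, hSJ]
      _ = J * (G * S * Gᵀ) * Jᵀ := by simp only [Matrix.transpose_mul, Matrix.mul_assoc]
      _ = _ := by rw [hKV]; simp only [Matrix.transpose_mul, Matrix.mul_assoc]
  refine ⟨J * V, κ, hκ, fun i => ?_, hAS, ?_⟩
  · have h := (h1K.conjTranspose_mul_mul_same V).diag_nonneg (i := i)
    have h3 : Vᵀ * (1 - G * S * Gᵀ) * V = 1 - Matrix.diagonal κ := by
      rw [hKV, Matrix.mul_sub, Matrix.sub_mul, Matrix.mul_one, hV']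
      congr 1
      calc _ = (Vᵀ * V) * Matrix.diagonal κ * (Vᵀ * V) := by simp only [Matrix.mul_assoc]
        _ = _ := by rw [hV', Matrix.one_mul, Matrix.mul_one]
    rw [Matrix.conjTranspose_eq_transpose_of_trivial, h3] at h
    simpa using h
  · have : Matrix.diagonal (fun i => 1 - κ i) = 1 - Matrix.diagonal κ := by
      rw [← Matrix.diagonal_one, Matrix.diagonal_sub]
    rw [this, Matrix.mul_sub, Matrix.sub_mul, Matrix.mul_one, hAA, ← hAS]
    abel

/-! ### Closedness of the completely positive cone, and duality -/

/-- In finite dimension the convex hull of a compact set is compact. -/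
theorem isCompact_convexHull_of_finiteDimensional {E : Type*} [AddCommGroup E] [Module ℝ E]
    [TopologicalSpace E] [ContinuousAdd E] [ContinuousSMul ℝ E] [FiniteDimensional ℝ E]
    {s : Set E} (hs : IsCompact s) : IsCompact (convexHull ℝ s) := by
  rcases s.eq_empty_or_nonempty with rfl | ⟨c, hc⟩
  · simp
  -- Carathéodory: this many points always suffice, so the hull is a continuous image of a simplex
  -- times a power of `s`. Shorter combinations are padded with weight zero at `c`.
  set N := Module.finrank ℝ E + 1
  have hcomp : IsCompact ((fun p : (Fin N → ℝ) × (Fin N → E) => ∑ i, p.1 i • p.2 i) ''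
      (stdSimplex ℝ (Fin N) ×ˢ Set.univ.pi fun _ => s)) :=
    ((isCompact_stdSimplex ℝ (Fin N)).prod (isCompact_univ_pi fun _ => hs)).image (by fun_prop)
  convert hcomp using 1
  refine Set.Subset.antisymm (fun x hx => ?_) ?_
  · obtain ⟨ι, _, z, w, hz, hind, hw, hw1, rfl⟩ := eq_pos_convex_span_of_mem_convexHull hx
    have hcard : Fintype.card ι ≤ Fintype.card (Fin N) := by
      rw [Fintype.card_fin]
      exact hind.card_le_finrank_succ.trans
        (Nat.succ_le_succ (Submodule.finrank_le _))
    obtain ⟨e⟩ := Function.Embedding.nonempty_of_card_le hcard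
    refine ⟨(Function.extend e w 0, Function.extend e z fun _ => c), ⟨⟨fun i => ?_, ?_⟩, ?_⟩, ?_⟩
    · by_cases h : ∃ a, e a = i
      · obtain ⟨a, rfl⟩ := h
        dsimp only
        rw [e.injective.extend_apply]
        exact (hw a).le
      · dsimp only
        rw [Function.extend_apply' _ _ _ h, Pi.zero_apply]
    · rw [← hw1]
      refine (Fintype.sum_of_injective e e.injective _ _ (fun i hi => ?_) fun a => ?_).symm
      · dsimp only
        rw [Function.extend_apply' _ _ _ hi, Pi.zero_apply]
      · dsimp only
        rw [e.injective.extend_apply]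
    · intro i _
      by_cases h : ∃ a, e a = i
      · obtain ⟨a, rfl⟩ := h
        simp only [e.injective.extend_apply]
        exact hz ⟨a, rfl⟩
      · simpa only [Function.extend_apply' _ _ _ h] using hc
    · refine (Fintype.sum_of_injective e e.injective _ _ (fun i hi => ?_) fun a => ?_).symm
      · simp only [Function.extend_apply' _ _ _ hi, Pi.zero_apply, zero_smul]
      · simp only [e.injective.extend_apply]
  · rintro _ ⟨⟨w, z⟩, ⟨⟨hw, hw1⟩, hz⟩, rfl⟩
    exact (convex_convexHull ℝ s).sum_mem (fun i _ => hw i) hw1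
      fun i hi => subset_convexHull ℝ s (hz i (Set.mem_univ i))

theorem zero_mem_completelyPositiveCone (n : ℕ) : 0 ∈ completelyPositiveCone n :=
  ⟨0, 0, by simp, by simp⟩

theorem vecMulVec_mem_completelyPositiveCone {n : ℕ} {b : Fin n → ℝ} (hb : ∀ i, 0 ≤ b i) :
    Matrix.vecMulVec b b ∈ completelyPositiveCone n := by
  refine ⟨1, Matrix.of fun _ => b, fun _ j => hb j, ?_⟩
  ext i j
  simp [Matrix.vecMulVec_apply, Matrix.mul_apply]

theorem add_mem_completelyPositiveCone {n : ℕ} {A B : Matrix (Fin n) (Fin n) ℝ}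
    (hA : A ∈ completelyPositiveCone n) (hB : B ∈ completelyPositiveCone n) :
    A + B ∈ completelyPositiveCone n := by
  obtain ⟨k, C, hC, rfl⟩ := hA
  obtain ⟨l, D, hD, rfl⟩ := hB
  refine ⟨k + l, Matrix.of fun i j => Fin.addCases (fun a => C a j) (fun a => D a j) i,
    fun i j => ?_, ?_⟩
  · induction i using Fin.addCases with
    | left i => simpa using hC i j
    | right i => simpa using hD i j
  · ext i j
    simp [Matrix.mul_apply, Fin.sum_univ_add]

theorem smul_mem_completelyPositiveCone {n : ℕ} {A : Matrix (Fin n) (Fin n) ℝ} {r : ℝ}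
    (hr : 0 ≤ r) (hA : A ∈ completelyPositiveCone n) : r • A ∈ completelyPositiveCone n := by
  obtain ⟨k, C, hC, rfl⟩ := hA
  refine ⟨k, √r • C, fun i j => mul_nonneg (Real.sqrt_nonneg r) (hC i j), ?_⟩
  rw [Matrix.transpose_smul, Matrix.smul_mul, Matrix.mul_smul, smul_smul, Real.mul_self_sqrt hr]

theorem convex_completelyPositiveCone (n : ℕ) : Convex ℝ (completelyPositiveCone n) :=
  fun _ hA _ hB _ _ ha hb _ => add_mem_completelyPositiveCone
    (smul_mem_completelyPositiveCone ha hA) (smul_mem_completelyPositiveCone hb hB)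

/-- The rank one completely positive matrices of trace at most one. -/
def rankOneBase (n : ℕ) : Set (Matrix (Fin n) (Fin n) ℝ) :=
  (fun b : Fin n → ℝ => Matrix.vecMulVec b b) '' {b | (∀ i, 0 ≤ b i) ∧ ∑ i, b i * b i ≤ 1}

theorem isCompact_rankOneBase (n : ℕ) : IsCompact (rankOneBase n) := by
  refine IsCompact.image ?_ (by fun_prop)
  refine (isCompact_univ_pi fun _ : Fin n => isCompact_Icc (a := (0 : ℝ)) (b := 1)).of_isClosed_subset
    ?_ ?_
  · simp only [Set.ofPred_and, Set.ofPred_forall]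
    refine IsClosed.inter (isClosed_iInter fun i => ?_) ?_
    · exact isClosed_le continuous_const (by fun_prop)
    · exact isClosed_le (by fun_prop) continuous_const
  · rintro b ⟨hb, hb1⟩ i -
    have : b i * b i ≤ ∑ i, b i * b i :=
      Finset.single_le_sum (f := fun i => b i * b i) (fun i _ => mul_self_nonneg _)
        (Finset.mem_univ i)
    exact ⟨hb i, by nlinarith [hb i]⟩

/-- `Bᵀ * B` is the sum of the rank one matrices of the rows of `B`. Normalizing each row and
weighting it by its squared norm gives a convex combination after division by the trace. Zero rows
normalize to zero, which is why the base allows trace below one. -/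
theorem exists_smul_mem_convexHull_rankOneBase {n : ℕ} {A : Matrix (Fin n) (Fin n) ℝ}
    (hA : A ∈ completelyPositiveCone n) :
    0 ≤ A.trace ∧ ∃ T ∈ convexHull ℝ (rankOneBase n), A = A.trace • T := by
  obtain ⟨k, B, hB, rfl⟩ := hA
  set w : Fin k → ℝ := fun l => ∑ i, B l i * B l i with hw
  have hw0 : ∀ l, 0 ≤ w l := fun l => Finset.sum_nonneg fun i _ => mul_self_nonneg _
  have htr : (Bᵀ * B).trace = ∑ l, w l := by
    simp only [Matrix.trace, Matrix.diag, Matrix.mul_apply, Matrix.transpose_apply, hw]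
    rw [Finset.sum_comm]
  have htr0 : 0 ≤ (Bᵀ * B).trace := htr ▸ Finset.sum_nonneg fun l _ => hw0 l
  refine ⟨htr0, ?_⟩
  set u : Fin k → Fin n → ℝ := fun l i => (√(w l))⁻¹ * B l i with hu
  have hss : ∀ l, √(w l) * √(w l) = w l := fun l => Real.mul_self_sqrt (hw0 l)
  have hz : ∀ l, w l = 0 → ∀ i, B l i = 0 := fun l hl i => by
    have := (Finset.sum_eq_zero_iff_of_nonneg (fun i _ => mul_self_nonneg (B l i))).1 hl i
      (Finset.mem_univ i)
    simpa using this
  have hwu : ∀ l i j, w l * (u l i * u l j) = B l i * B l j := fun l i j => by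
    by_cases h : w l = 0
    · simp [h, hz l h]
    · have h' : √(w l) ≠ 0 := fun h0 => h (by rw [← hss, h0, zero_mul])
      calc w l * (u l i * u l j) =
          (w l * ((√(w l))⁻¹ * (√(w l))⁻¹)) * (B l i * B l j) := by simp only [hu]; ring
        _ = _ := by rw [← mul_inv, hss, mul_inv_cancel₀ h, one_mul]
  have hmem : ∀ l, Matrix.vecMulVec (u l) (u l) ∈ rankOneBase n := fun l => by
    refine ⟨u l, ⟨fun i => mul_nonneg (inv_nonneg.2 (Real.sqrt_nonneg _)) (hB l i), ?_⟩, rfl⟩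
    by_cases h : w l = 0
    · simp [hu, h]
    · have : w l * ∑ i, u l i * u l i = w l := by
        rw [Finset.mul_sum]
        simp_rw [hwu, hw]
      have h1 := mul_left_cancel₀ h (this.trans (mul_one _).symm)
      exact h1.le
  by_cases h : (Bᵀ * B).trace = 0
  · refine ⟨0, subset_convexHull ℝ _ ⟨0, by simp, by simp⟩, ?_⟩
    rw [smul_zero]
    rw [htr] at h
    have h0 := (Finset.sum_eq_zero_iff_of_nonneg (fun l _ => hw0 l)).1 h
    ext i j
    simp [Matrix.mul_apply, hz _ (h0 _ (Finset.mem_univ _))]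
  · refine ⟨∑ l, (w l / (Bᵀ * B).trace) • Matrix.vecMulVec (u l) (u l),
      (convex_convexHull ℝ _).sum_mem (fun l _ => div_nonneg (hw0 l) htr0) ?_
        (fun l _ => subset_convexHull ℝ _ (hmem l)), ?_⟩
    · rw [← Finset.sum_div, ← htr, div_self h]
    · rw [Finset.smul_sum]
      ext i j
      rw [Matrix.sum_apply, Matrix.mul_apply]
      refine Finset.sum_congr rfl fun l _ => ?_
      simp only [Matrix.smul_apply, Matrix.vecMulVec_apply, smul_eq_mul, Matrix.transpose_apply,
        ← hwu l i j]
      rw [← mul_assoc (Matrix.trace _), mul_div_cancel₀ _ h]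

/-- Near `A` the trace is below `A.trace + 1`, and the members of the cone with such a trace lie in
the compact set `K` of bounded multiples of the hull of the base. -/
theorem isClosed_completelyPositiveCone (n : ℕ) : IsClosed (completelyPositiveCone n) := by
  refine isClosed_of_closure_subset fun A hA => ?_
  set K := (fun p : ℝ × Matrix (Fin n) (Fin n) ℝ => p.1 • p.2) ''
    (Set.Icc 0 (A.trace + 1) ×ˢ convexHull ℝ (rankOneBase n))
  have hT : IsCompact (convexHull ℝ (rankOneBase n)) := by
    exact isCompact_convexHull_of_finiteDimensional (isCompact_rankOneBase n)
  have hK : IsClosed K := by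
    refine IsCompact.isClosed ?_
    exact (isCompact_Icc.prod hT).image (by fun_prop)
  have hKC : K ⊆ completelyPositiveCone n := by
    rintro _ ⟨⟨r, T⟩, ⟨hr, hT⟩, rfl⟩
    refine smul_mem_completelyPositiveCone hr.1 ?_
    refine convexHull_min ?_ (convex_completelyPositiveCone n) hT
    rintro _ ⟨b, hb, rfl⟩
    exact vecMulVec_mem_completelyPositiveCone hb.1
  have hU : IsOpen {B : Matrix (Fin n) (Fin n) ℝ | B.trace < A.trace + 1} :=
    isOpen_lt (by fun_prop) continuous_const
  refine hKC (hK.closure_eq ▸ closure_mono ?_ (hU.inter_closure ⟨?_, hA⟩))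
  · rintro B ⟨hB1, hB⟩
    obtain ⟨h0, T, hT, hBT⟩ := exists_smul_mem_convexHull_rankOneBase hB
    exact ⟨(B.trace, T), ⟨⟨h0, le_of_lt hB1⟩, hT⟩, hBT.symm⟩
  · simp

/-- A symmetric matrix having a nonnegative product with all symmetric copositive matrices is
completely positive. -/
theorem mem_completelyPositiveCone_of_forall_copositive {n : ℕ} {D : Matrix (Fin n) (Fin n) ℝ}
    (hD : Dᵀ = D) (h : ∀ M ∈ copositiveCone n, Mᵀ = M → 0 ≤ ∑ i, ∑ j, M i j * D i j) :
    D ∈ completelyPositiveCone n := by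
  by_contra hDC
  have : LocallyConvexSpace ℝ (Matrix (Fin n) (Fin n) ℝ) :=
    inferInstanceAs (LocallyConvexSpace ℝ (Fin n → Fin n → ℝ))
  obtain ⟨L, u, hL, hu⟩ := geometric_hahn_banach_closed_point (convex_completelyPositiveCone n)
    (isClosed_completelyPositiveCone n) hDC
  have hu0 : 0 < u := by simpa using hL 0 (zero_mem_completelyPositiveCone n)
  -- Were `L A > 0`, the multiple of `A` by `u / L A` would stay in the cone and attain the value
  -- `u`.
  have hLle : ∀ A ∈ completelyPositiveCone n, L A ≤ 0 := fun A hA => by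
    by_contra! hA0
    have := hL _ (smul_mem_completelyPositiveCone (div_nonneg hu0.le hA0.le) hA)
    rw [map_smul, smul_eq_mul, div_mul_cancel₀ _ hA0.ne'] at this
    exact lt_irrefl _ this
  have hLsum : ∀ A, L A = ∑ i, ∑ j, A i j * L (Matrix.single i j 1) := fun A => by
    conv_lhs => rw [Matrix.matrix_eq_sum_single A]
    simp only [map_sum]
    refine Finset.sum_congr rfl fun i _ => Finset.sum_congr rfl fun j _ => ?_
    rw [← smul_eq_mul, ← map_smul, Matrix.smul_single, smul_eq_mul, mul_one]
  -- The separating functional, negated and symmetrized: on symmetric matrices, pairing with `M` is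
  -- `-2 * L`.
  set M : Matrix (Fin n) (Fin n) ℝ := Matrix.of fun i j =>
    -(L (Matrix.single i j 1) + L (Matrix.single j i 1)) with hM
  have hMA : ∀ A : Matrix (Fin n) (Fin n) ℝ, Aᵀ = A → ∑ i, ∑ j, M i j * A i j = -2 * L A := by
    intro A hA
    have h2 : ∑ i, ∑ j, A i j * L (Matrix.single j i 1) = L A := by
      rw [Finset.sum_comm, hLsum]
      refine Finset.sum_congr rfl fun i _ => Finset.sum_congr rfl fun j _ => ?_
      rw [← Matrix.transpose_apply A, hA]
    calc _ = -(∑ i, ∑ j, A i j * L (Matrix.single i j 1)) -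
          ∑ i, ∑ j, A i j * L (Matrix.single j i 1) := by
          simp only [← Finset.sum_neg_distrib, ← Finset.sum_sub_distrib]
          refine Finset.sum_congr rfl fun i _ => Finset.sum_congr rfl fun j _ => ?_
          simp only [hM, Matrix.of_apply]
          ring
      _ = _ := by rw [h2, ← hLsum]; ring
  have := h M (fun x hx => ?_) ?_
  · rw [hMA D hD] at this
    linarith
  · have h1 := hMA (Matrix.vecMulVec x x) (Matrix.transpose_vecMulVec x x)
    have h2 := hLle _ (vecMulVec_mem_completelyPositiveCone hx)
    have h3 : x ⬝ᵥ M *ᵥ x = ∑ i, ∑ j, M i j * Matrix.vecMulVec x x i j := by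
      simp only [dotProduct, Matrix.mulVec, Matrix.vecMulVec_apply, Finset.mul_sum]
      refine Finset.sum_congr rfl fun i _ => Finset.sum_congr rfl fun j _ => ?_
      ring
    rw [h3, h1]
    linarith
  · ext i j
    simp only [hM, Matrix.transpose_apply, Matrix.of_apply]
    ring

/-- Completely positive and copositive matrices have nonnegative products. -/
theorem sum_mul_nonneg_of_copositive {n : ℕ} {A M : Matrix (Fin n) (Fin n) ℝ}
    (hA : A ∈ completelyPositiveCone n) (hM : M ∈ copositiveCone n) :
    0 ≤ ∑ i, ∑ j, M i j * A i j := by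
  obtain ⟨k, B, hB, rfl⟩ := hA
  have : ∑ i, ∑ j, M i j * (Bᵀ * B) i j = ∑ l, B l ⬝ᵥ M *ᵥ B l := by
    simp only [Matrix.mul_apply, Matrix.transpose_apply, dotProduct, Matrix.mulVec,
      Finset.mul_sum]
    rw [Finset.sum_comm' (s' := fun _ => Finset.univ) (t' := Finset.univ) (by simp)]
    simp_rw [fun j => Finset.sum_comm (s := Finset.univ (α := Fin n)) (t := Finset.univ (α := Fin k))
      (f := fun i l => M i j * (B l i * B l j))]
    rw [Finset.sum_comm]
    refine Finset.sum_congr rfl fun l _ => ?_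
    rw [Finset.sum_comm]
    refine Finset.sum_congr rfl fun i _ => Finset.sum_congr rfl fun j _ => ?_
    ring
  rw [this]
  exact Finset.sum_nonneg fun l _ => hM _ (hB l)

/-! ### Rotation invariant measures and elliptical laws -/

/-- A measure invariant under all linear isometries. -/
def RotationInvariant {n : ℕ} (ν : Measure (Vec n)) : Prop :=
  ∀ O : Vec n ≃ₗᵢ[ℝ] Vec n, ν.map O = ν

/-- The linear map of a matrix on Euclidean space. -/
noncomputable abbrev matCLM {n : ℕ} (A : Matrix (Fin n) (Fin n) ℝ) : Vec n →L[ℝ] Vec n :=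
  Matrix.toEuclideanCLM (𝕜 := ℝ) A

theorem inner_matCLM_left {n : ℕ} (A : Matrix (Fin n) (Fin n) ℝ) (x y : Vec n) :
    inner ℝ (matCLM A x) y = inner ℝ x (matCLM Aᵀ y) := by
  rw [real_inner_comm, Matrix.inner_toEuclideanCLM, Matrix.inner_toEuclideanCLM,
    Matrix.dotProduct_mulVec, dotProduct_comm, Matrix.mulVec_transpose]

theorem matCLM_apply {n : ℕ} (A : Matrix (Fin n) (Fin n) ℝ) (x : Vec n) (i : Fin n) :
    matCLM A x i = ∑ j, A i j * x j := rfl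

theorem rotationInvariant_of_charFun {n : ℕ} {ν : Measure (Vec n)} [IsFiniteMeasure ν] {φ : ℝ → ℝ}
    (h : ∀ t : Vec n, charFun ν t = ((φ (t.ofLp ⬝ᵥ t.ofLp) : ℝ) : ℂ)) : RotationInvariant ν := by
  intro O
  have : IsFiniteMeasure (ν.map O) := Measure.isFiniteMeasure_map ν O
  refine Measure.ext_of_charFun (funext fun t => ?_)
  have hO : charFun (ν.map O) t = charFun ν (O.symm t) := by
    rw [charFun_apply, charFun_apply,
      integral_map O.continuous.measurable.aemeasurable (by fun_prop)]
    congr 1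
    funext x
    rw [← O.inner_map_map x, O.apply_symm_apply]
  have hn : ∀ s : Vec n, s.ofLp ⬝ᵥ s.ofLp = ‖s‖ ^ 2 := fun s => by
    rw [EuclideanSpace.real_norm_sq_eq, dotProduct]
    simp only [sq]
  rw [hO, h, h, hn, hn, O.symm.norm_map]

/-- The stochastic representation, obtained by comparing characteristic functions. Any factor `A` of
`S` is allowed, so `X` and `Y` can share `ν` and the congruence matrix. -/
theorem IsElliptical.map_eq {Ω : Type*} [MeasurableSpace Ω] {n : ℕ} {P : Measure Ω}
    [IsFiniteMeasure P] {X : Ω → Vec n} {μ : Vec n} {S : Matrix (Fin n) (Fin n) ℝ} {φ : ℝ → ℝ}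
    (hX : IsElliptical P X μ S φ) {ν : Measure (Vec n)} [IsFiniteMeasure ν]
    (hν : ∀ t : Vec n, charFun ν t = ((φ (t.ofLp ⬝ᵥ t.ofLp) : ℝ) : ℂ))
    {A : Matrix (Fin n) (Fin n) ℝ} (hA : S = A * Aᵀ) :
    P.map X = ν.map fun x => μ + matCLM A x := by
  have h1 : IsFiniteMeasure (P.map X) := Measure.isFiniteMeasure_map P X
  have h2 : IsFiniteMeasure (ν.map fun x => μ + matCLM A x) := Measure.isFiniteMeasure_map ν _
  refine Measure.ext_of_charFun (funext fun t => ?_)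
  rw [hX.charFun_eq, charFun_apply, integral_map (by fun_prop) (by fun_prop)]
  simp_rw [inner_add_left, Complex.ofReal_add, add_mul, Complex.exp_add, integral_const_mul,
    inner_matCLM_left]
  rw [← charFun_apply, hν, hA]
  congr 2
  · rw [mul_comm, EuclideanSpace.inner_eq_star_dotProduct]
    simp
  · rw [← Matrix.mulVec_mulVec, Matrix.dotProduct_mulVec, ← Matrix.mulVec_transpose,
      Matrix.ofLp_toEuclideanCLM]

/-- The reflection in the hyperplane orthogonal to `u - v` exchanges the two vectors. -/
theorem exists_isometry_map_eq {n : ℕ} {u v : Vec n} (h : ‖u‖ = ‖v‖) :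
    ∃ O : Vec n ≃ₗᵢ[ℝ] Vec n, O u = v :=
  ⟨_, Submodule.reflection_sub h⟩

theorem RotationInvariant.integral_comp {n : ℕ} {ν : Measure (Vec n)} (hν : RotationInvariant ν)
    (O : Vec n ≃ₗᵢ[ℝ] Vec n) (f : Vec n → ℝ) : ∫ x, f (O x) ∂ν = ∫ x, f x ∂ν := by
  conv_rhs => rw [← hν O]
  exact (O.toHomeomorph.measurableEmbedding.integral_map f).symm

theorem RotationInvariant.integrable_comp {n : ℕ} {ν : Measure (Vec n)} (hν : RotationInvariant ν)
    (O : Vec n ≃ₗᵢ[ℝ] Vec n) {f : Vec n → ℝ} (hf : Integrable f ν) :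
    Integrable (fun x => f (O x)) ν := by
  rw [← hν O] at hf
  exact (O.toHomeomorph.measurableEmbedding.integrable_map_iff).1 hf

theorem RotationInvariant.integral_inner_eq_zero {n : ℕ} {ν : Measure (Vec n)}
    (hν : RotationInvariant ν) (b : Vec n) : ∫ x, inner ℝ b x ∂ν = 0 := by
  have h := hν.integral_comp (LinearIsometryEquiv.neg ℝ) (fun x => inner ℝ b x)
  simp only [LinearIsometryEquiv.coe_neg, inner_neg_right, integral_neg] at h
  linarith

theorem exists_isometry_inner {n : ℕ} {u : Vec n} (hu : ‖u‖ = 1) (b : Vec n) :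
    ∃ O : Vec n ≃ₗᵢ[ℝ] Vec n, ∀ x, inner ℝ b x = ‖b‖ * inner ℝ u (O x) := by
  obtain ⟨O, hO⟩ := exists_isometry_map_eq (u := b) (v := ‖b‖ • u) (by simp [norm_smul, hu])
  refine ⟨O, fun x => ?_⟩
  rw [← O.inner_map_map, hO, real_inner_smul_left]

theorem inner_mul_inner_eq {n : ℕ} (b c x : Vec n) :
    inner ℝ b x * inner ℝ c x =
      (1 / 4) * ((inner ℝ (b + c) x) ^ 2 - (inner ℝ (b - c) x) ^ 2) := by
  rw [inner_add_left, inner_sub_left]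
  ring

theorem RotationInvariant.integrable_inner_sq {n : ℕ} {ν : Measure (Vec n)}
    (hν : RotationInvariant ν) {a : Vec n} (ha : a ≠ 0)
    (hint : Integrable (fun x => (inner ℝ a x) ^ 2) ν) (b : Vec n) :
    Integrable (fun x => (inner ℝ b x) ^ 2) ν := by
  have ha' : ‖a‖ ≠ 0 := norm_ne_zero_iff.2 ha
  obtain ⟨O, hO⟩ := exists_isometry_inner (u := ‖a‖⁻¹ • a)
    (by rw [norm_smul, norm_inv, norm_norm, inv_mul_cancel₀ ha']) b
  simp_rw [hO, real_inner_smul_left, mul_pow, ← mul_assoc]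
  exact (hν.integrable_comp O hint).const_mul _

theorem integrable_inner_mul_inner {n : ℕ} {ν : Measure (Vec n)}
    (hint : ∀ b : Vec n, Integrable (fun x => (inner ℝ b x) ^ 2) ν) (b c : Vec n) :
    Integrable (fun x => inner ℝ b x * inner ℝ c x) ν := by
  simp_rw [inner_mul_inner_eq]
  exact ((hint _).sub (hint _)).const_mul _

/-- The covariance of a rotation invariant measure is a multiple of the identity. -/
theorem RotationInvariant.integral_inner_mul_inner {n : ℕ} {ν : Measure (Vec n)}
    (hν : RotationInvariant ν) (hint : ∀ b : Vec n, Integrable (fun x => (inner ℝ b x) ^ 2) ν)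
    {u : Vec n} (hu : ‖u‖ = 1) (b c : Vec n) :
    ∫ x, inner ℝ b x * inner ℝ c x ∂ν = (∫ x, (inner ℝ u x) ^ 2 ∂ν) * inner ℝ b c := by
  have hsq : ∀ b : Vec n, ∫ x, (inner ℝ b x) ^ 2 ∂ν = (∫ x, (inner ℝ u x) ^ 2 ∂ν) * ‖b‖ ^ 2 := by
    intro b
    obtain ⟨O, hO⟩ := exists_isometry_inner hu b
    simp_rw [hO, mul_pow, integral_const_mul]
    rw [hν.integral_comp O fun x => (inner ℝ u x) ^ 2, mul_comm]
  simp_rw [inner_mul_inner_eq b c]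
  rw [integral_const_mul, integral_sub (hint _) (hint _), hsq (b + c), hsq (b - c), norm_add_sq_real,
    norm_sub_sq_real]
  ring

/-- A rotation invariant probability measure with vanishing second moments has trivial
characteristic function. -/
theorem RotationInvariant.charFun_eq_one {n : ℕ} {ν : Measure (Vec n)} [IsProbabilityMeasure ν]
    (hν : RotationInvariant ν) (hint : ∀ b : Vec n, Integrable (fun x => (inner ℝ b x) ^ 2) ν)
    {u : Vec n} (hu : ‖u‖ = 1) (h0 : ∫ x, (inner ℝ u x) ^ 2 ∂ν = 0) (t : Vec n) :
    charFun ν t = 1 := by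
  have h := hν.integral_inner_mul_inner hint hu t t
  rw [h0, zero_mul] at h
  simp_rw [← sq] at h
  have hae := (integral_eq_zero_iff_of_nonneg (fun x => sq_nonneg _) (hint t)).1 h
  rw [charFun_apply]
  calc _ = ∫ _, (1 : ℂ) ∂ν := by
        refine integral_congr_ae ?_
        filter_upwards [hae] with x hx
        have : inner ℝ t x = 0 := by simpa using hx
        rw [real_inner_comm, this]
        simp
    _ = 1 := by simp

theorem RotationInvariant.restrict_closedBall {n : ℕ} {ν : Measure (Vec n)}
    (hν : RotationInvariant ν) (r : ℝ) :
    RotationInvariant (ν.restrict (Metric.closedBall 0 r)) := by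
  intro O
  have h : O ⁻¹' Metric.closedBall 0 r = Metric.closedBall 0 r := by
    ext x
    simp
  conv_lhs => rw [← h]
  have h2 := O.toHomeomorph.measurableEmbedding.restrict_map ν (Metric.closedBall 0 r)
  rw [LinearIsometryEquiv.coe_toHomeomorph, hν] at h2
  exact h2.symm

/-! ### The divergence inequality -/

/-- For a radial density `p`, minus half of the tail integral of `p` in the variable `‖x‖²` has
gradient `p x • x`. -/
theorem exists_potential_of_radial {n : ℕ} {u : Vec n} (hu : ‖u‖ = 1) {p : Vec n → ℝ}
    (hp : Continuous p) (hp0 : ∀ x, 0 ≤ p x) (hrad : ∀ x y, ‖x‖ = ‖y‖ → p x = p y) {R : ℝ}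
    (hR : 0 ≤ R) (hsupp : ∀ x, R ≤ ‖x‖ → p x = 0) :
    ∃ G : Vec n → ℝ, (∀ x, HasFDerivAt G (-(p x • innerSL ℝ x)) x) ∧ (∀ x, 0 ≤ G x) ∧
      HasCompactSupport G := by
  -- The profile of `p` as a function of the squared radius, in which the potential is
  -- differentiable at the origin too. The factor `1 / 2` in `Φ` cancels the 2 in the gradient of
  -- `‖x‖ ^ 2`.
  set q : ℝ → ℝ := fun v => p (√v • u) with hq
  have hqc : Continuous q := by fun_prop
  have hqp : ∀ x, q (‖x‖ ^ 2) = p x := fun x => by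
    refine hrad _ _ ?_
    rw [Real.sqrt_sq (norm_nonneg x), norm_smul, hu, mul_one, norm_norm]
  have hq0 : ∀ v, R ^ 2 ≤ v → q v = 0 := fun v hv => by
    refine hsupp _ ?_
    rw [norm_smul, hu, mul_one, Real.norm_of_nonneg (Real.sqrt_nonneg v)]
    exact Real.le_sqrt_of_sq_le hv
  set Φ : ℝ → ℝ := fun w => (1 / 2) * ∫ v in w..R ^ 2, q v with hΦ
  have hΦd : ∀ w, HasDerivAt Φ ((1 / 2) * -q w) w := fun w =>
    (intervalIntegral.integral_hasDerivAt_left (hqc.intervalIntegrable _ _)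
      hqc.stronglyMeasurable.stronglyMeasurableAtFilter hqc.continuousAt).const_mul _
  have hΦz : ∀ w, R ^ 2 ≤ w → Φ w = 0 := fun w hw => by
    simp only [hΦ]
    rw [intervalIntegral.integral_symm, intervalIntegral.integral_congr (g := fun _ => 0)]
    · simp
    · intro v hv
      rw [Set.uIcc_of_le hw] at hv
      exact hq0 v hv.1
  refine ⟨fun x => Φ (‖x‖ ^ 2), fun x => ?_, fun x => ?_, ?_⟩
  · have h1 : HasFDerivAt (fun x : Vec n => ‖x‖ ^ 2) (2 • innerSL ℝ x) x :=
      (hasStrictFDerivAt_norm_sq x).hasFDerivAt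
    refine ((hΦd _).comp_hasFDerivAt x h1).congr_fderiv ?_
    ext v
    simp only [hqp, smul_apply, neg_apply, smul_eq_mul,
      nsmul_eq_mul]
    push_cast
    ring
  · rcases le_total (‖x‖ ^ 2) (R ^ 2) with h | h
    · exact mul_nonneg (by norm_num) (intervalIntegral.integral_nonneg h fun v _ => hp0 _)
    · exact (hΦz _ h).ge
  · refine HasCompactSupport.of_support_subset_isCompact (isCompact_closedBall (0 : Vec n) R) ?_
    intro x hx
    by_contra hxR
    rw [mem_closedBall_zero_iff, not_le] at hxR
    exact hx (hΦz _ (pow_le_pow_left₀ hR hxR.le 2))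

/-- Integration by parts in each coordinate against the potential `G`, with `∇G = -p x`, leaves the
integral of `G` times the divergence. -/
theorem integral_radial_density_nonneg {n : ℕ} {u : Vec n} (hu : ‖u‖ = 1) {p : Vec n → ℝ}
    (hp : Continuous p) (hp0 : ∀ x, 0 ≤ p x) (hrad : ∀ x y, ‖x‖ = ‖y‖ → p x = p y) {R : ℝ}
    (hR : 0 ≤ R) (hsupp : ∀ x, R ≤ ‖x‖ → p x = 0) {F : Fin n → Vec n → ℝ}
    (hF : ∀ i, ContDiff ℝ 1 (F i))
    (hdiv : ∀ x, 0 ≤ ∑ i, fderiv ℝ (F i) x (EuclideanSpace.single i 1)) :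
    0 ≤ ∫ x, (∑ i, F i x * x i) * p x := by
  obtain ⟨G, hG, hG0, hGc⟩ := exists_potential_of_radial hu hp hp0 hrad hR hsupp
  have hGcont : Continuous G := continuous_iff_continuousAt.2 fun x => (hG x).continuousAt
  have hpc : HasCompactSupport p := by
    refine HasCompactSupport.of_support_subset_isCompact (isCompact_closedBall (0 : Vec n) R) ?_
    intro x hx
    by_contra hxR
    rw [mem_closedBall_zero_iff, not_le] at hxR
    exact hx (hsupp x hxR.le)
  have hFc : ∀ i, Continuous (F i) := fun i => (hF i).continuous
  have hF' : ∀ i, Continuous fun x => fderiv ℝ (F i) x (EuclideanSpace.single i 1) := fun i =>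
    ((hF i).continuous_fderiv one_ne_zero).clm_apply continuous_const
  have hGf : ∀ i x, fderiv ℝ G x (EuclideanSpace.single i 1) = -(p x * x i) := fun i x => by
    rw [(hG x).fderiv]
    simp [EuclideanSpace.inner_single_right]
  have hint1 : ∀ i, Integrable fun x =>
      fderiv ℝ (F i) x (EuclideanSpace.single i 1) * G x := fun i =>
    ((hF' i).mul hGcont).integrable_of_hasCompactSupport hGc.mul_left
  have hint2 : ∀ i, Integrable fun x => F i x * x i * p x := fun i =>
    Continuous.integrable_of_hasCompactSupport (by fun_prop) hpc.mul_left
  have hi : ∀ i, ∫ x, F i x * x i * p x =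
      ∫ x, fderiv ℝ (F i) x (EuclideanSpace.single i 1) * G x := fun i => by
    have h := integral_mul_fderiv_eq_neg_fderiv_mul_of_integrable
      (μ := (volume : Measure (Vec n))) (f := F i) (g := G) (v := EuclideanSpace.single i 1)
      (hint1 i) ?_ ?_ (fun x _ => (hF i).differentiable (by norm_num) x)
      (fun x _ => (hG x).differentiableAt)
    · simp_rw [hGf, mul_neg, integral_neg, neg_inj] at h
      rw [← h]
      congr 1
      funext x
      ring
    · simp_rw [hGf]
      refine (hint2 i).neg.congr (Filter.Eventually.of_forall fun x => ?_)
      simp only [Pi.neg_apply]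
      ring
    · exact ((hFc i).mul hGcont).integrable_of_hasCompactSupport hGc.mul_left
  simp_rw [Finset.sum_mul]
  rw [integral_finsetSum _ fun i _ => hint2 i]
  simp_rw [hi]
  rw [← integral_finsetSum _ fun i _ => hint1 i]
  refine integral_nonneg fun x => ?_
  simp only [← Finset.sum_mul]
  exact mul_nonneg (hdiv x) (hG0 x)

/-- The tent function of radius `δ`. -/
noncomputable def tent {n : ℕ} (δ : ℝ) (b : Vec n) : ℝ := max 0 (δ - ‖b‖)

theorem tent_nonneg {n : ℕ} (δ : ℝ) (b : Vec n) : 0 ≤ tent δ b := le_max_left _ _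

theorem continuous_tent {n : ℕ} (δ : ℝ) : Continuous (tent (n := n) δ) := by
  unfold tent
  fun_prop

theorem tent_le {n : ℕ} {δ : ℝ} (hδ : 0 ≤ δ) (b : Vec n) : tent δ b ≤ δ :=
  max_le hδ (by linarith [norm_nonneg b])

theorem norm_lt_of_tent_ne_zero {n : ℕ} {δ : ℝ} {b : Vec n} (h : tent δ b ≠ 0) : ‖b‖ < δ := by
  by_contra! hb
  exact h (max_eq_left (by linarith))

theorem hasCompactSupport_tent {n : ℕ} (δ : ℝ) : HasCompactSupport (tent (n := n) δ) := by
  refine HasCompactSupport.of_support_subset_isCompact (isCompact_closedBall (0 : Vec n) δ) ?_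
  intro x hx
  exact mem_closedBall_zero_iff.2 (norm_lt_of_tent_ne_zero hx).le

theorem integral_tent_pos {n : ℕ} {δ : ℝ} (hδ : 0 < δ) : 0 < ∫ b : Vec n, tent δ b :=
  (continuous_tent δ).integral_pos_of_hasCompactSupport_nonneg_nonzero (hasCompactSupport_tent δ)
    (tent_nonneg δ) (x := 0) (by simp [tent, hδ.le, hδ.ne'])

/-- If a continuously differentiable vector field has nonnegative divergence then its radial
component has nonnegative integral against boundedly supported rotation invariant measures. -/
theorem RotationInvariant.integral_radial_nonneg {n : ℕ} {ν : Measure (Vec n)} [IsFiniteMeasure ν]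
    (hν : RotationInvariant ν) {u : Vec n} (hu : ‖u‖ = 1) {N : ℝ} (hN0 : 0 ≤ N)
    (hN : ∀ᵐ x ∂ν, ‖x‖ ≤ N)
    {F : Fin n → Vec n → ℝ} (hF : ∀ i, ContDiff ℝ 1 (F i))
    (hdiv : ∀ x, 0 ≤ ∑ i, fderiv ℝ (F i) x (EuclideanSpace.single i 1)) :
    0 ≤ ∫ x, ∑ i, F i x * x i ∂ν := by
  set H : Vec n → ℝ := fun x => ∑ i, F i x * x i with hH
  have hFc : ∀ i, Continuous (F i) := fun i => (hF i).continuous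
  have hHc : Continuous H := by fun_prop
  obtain ⟨C, hC⟩ := (isCompact_closedBall (0 : Vec n) (N + 1)).exists_bound_of_continuousOn
    hHc.continuousOn
  have hHint : Integrable H ν := by
    refine Integrable.mono' (integrable_const C) hHc.aestronglyMeasurable ?_
    filter_upwards [hN] with x hx
    exact hC x (mem_closedBall_zero_iff.2 (by linarith))
  -- Smoothing `ν` by a narrow tent gives a radial density `p`, for which the inequality is known;
  -- uniform continuity of `H` bounds the smoothing error by `ε`.
  have key : ∀ ε > 0, 0 ≤ ∫ x, (H x + ε) ∂ν := by
    intro ε hε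
    obtain ⟨δ₀, hδ₀, hu₀⟩ := Metric.uniformContinuousOn_iff.1
      ((isCompact_closedBall (0 : Vec n) (N + 1)).uniformContinuousOn_of_continuous
        hHc.continuousOn) ε hε
    -- The bound 1 keeps the smoothed density inside the ball of radius `N + 1`, where `H` is
    -- bounded and uniformly continuous.
    set δ := min δ₀ 1
    have hδ : 0 < δ := lt_min hδ₀ one_pos
    set p : Vec n → ℝ := fun y => ∫ x, tent δ (y - x) ∂ν with hp
    have htc : Continuous (tent (n := n) δ) := continuous_tent δ
    have hpc : Continuous p := by
      refine continuous_of_dominated (bound := fun _ => δ)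
        (fun y => (by fun_prop : Continuous fun x => tent δ (y - x)).aestronglyMeasurable) ?_
        (integrable_const δ) (Filter.Eventually.of_forall fun x => by fun_prop)
      intro y
      refine Filter.Eventually.of_forall fun x => ?_
      rw [Real.norm_of_nonneg (tent_nonneg _ _)]
      exact tent_le hδ.le _
    have hprad : ∀ x y, ‖x‖ = ‖y‖ → p x = p y := by
      intro x y hxy
      obtain ⟨O, hO⟩ := exists_isometry_map_eq hxy
      simp only [hp]
      rw [← hO, ← hν.integral_comp O fun z => tent δ (O x - z)]
      congr 1
      funext z
      rw [← map_sub]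
      simp only [tent, O.norm_map]
    have hpsupp : ∀ y, N + 1 ≤ ‖y‖ → p y = 0 := by
      intro y hy
      refine integral_eq_zero_of_ae ?_
      filter_upwards [hN] with x hx
      by_contra h
      have h1 := norm_lt_of_tent_ne_zero h
      have h2 : ‖y‖ ≤ ‖y - x‖ + ‖x‖ := norm_le_norm_sub_add y x
      have h3 : δ ≤ 1 := min_le_right _ _
      linarith
    have hpos := integral_radial_density_nonneg hu hpc
      (fun y => integral_nonneg fun x => tent_nonneg _ _) hprad (by linarith) hpsupp hF hdiv
    have hprod : Integrable (Function.uncurry fun y x => H y * tent δ (y - x))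
        (volume.prod ν) := by
      have hind : Integrable
          ((Metric.closedBall (0 : Vec n) (N + 1)).indicator fun _ => C * δ) volume :=
        (integrable_indicator_iff measurableSet_closedBall).2
          (integrableOn_const (isCompact_closedBall _ _).measure_lt_top.ne)
      refine Integrable.mono' (hind.comp_fst ν)
        (by fun_prop : Continuous _).aestronglyMeasurable ?_
      filter_upwards [Measure.quasiMeasurePreserving_snd.ae hN] with z hz
      simp only [Function.uncurry]
      by_cases h : tent δ (z.1 - z.2) = 0
      · rw [h, mul_zero, norm_zero]
        refine Set.indicator_nonneg (fun y hy => ?_) _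
        exact mul_nonneg ((norm_nonneg _).trans (hC y hy)) hδ.le
      · have h1 := norm_lt_of_tent_ne_zero h
        have h2 : ‖z.1‖ ≤ ‖z.1 - z.2‖ + ‖z.2‖ := norm_le_norm_sub_add _ _
        have h3 : δ ≤ 1 := min_le_right _ _
        have hz1 : z.1 ∈ Metric.closedBall (0 : Vec n) (N + 1) :=
          mem_closedBall_zero_iff.2 (by linarith)
        rw [Set.indicator_of_mem hz1, norm_mul, Real.norm_of_nonneg (tent_nonneg _ _)]
        exact mul_le_mul (hC _ hz1) (tent_le hδ.le _) (tent_nonneg _ _)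
          ((norm_nonneg _).trans (hC _ hz1))
    have hswap : ∫ y, H y * p y = ∫ x, (∫ y, H y * tent δ (y - x)) ∂ν := by
      simp only [hp, ← integral_const_mul]
      exact integral_integral_swap hprod
    set I := ∫ b : Vec n, tent δ b with hI
    have hIpos : 0 < I := integral_tent_pos hδ
    have htint : ∀ x : Vec n, Integrable fun y => tent δ (y - x) := fun x =>
      ((continuous_tent δ).integrable_of_hasCompactSupport (hasCompactSupport_tent δ)).comp_sub_right x
    have hle : ∫ x, (∫ y, H y * tent δ (y - x)) ∂ν ≤ ∫ x, (H x + ε) * I ∂ν := by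
      refine integral_mono_ae hprod.integral_prod_right ((hHint.add (integrable_const ε)).mul_const I) ?_
      filter_upwards [hN] with x hx
      have hIx : (H x + ε) * I = ∫ y, (H x + ε) * tent δ (y - x) := by
        rw [integral_const_mul, integral_sub_right_eq_self (tent δ) x]
      rw [hIx]
      refine integral_mono (((hHc.mul (by fun_prop)).integrable_of_hasCompactSupport
        ((hasCompactSupport_tent δ).comp_homeomorph (Homeomorph.subRight x)).mul_left))
        ((htint x).const_mul _) fun y => ?_
      by_cases h : tent δ (y - x) = 0
      · simp only [h, mul_zero, le_refl]
      · have h1 := norm_lt_of_tent_ne_zero h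
        have h2 : ‖y‖ ≤ ‖y - x‖ + ‖x‖ := norm_le_norm_sub_add _ _
        have h3 : δ ≤ 1 := min_le_right _ _
        have h4 : δ ≤ δ₀ := min_le_left _ _
        have h5 := hu₀ y (mem_closedBall_zero_iff.2 (by linarith)) x
          (mem_closedBall_zero_iff.2 (by linarith)) (by rw [dist_eq_norm]; linarith)
        rw [Real.dist_eq] at h5
        exact mul_le_mul_of_nonneg_right (by linarith [le_abs_self (H y - H x)]) (tent_nonneg _ _)
    have : 0 ≤ (∫ x, (H x + ε) ∂ν) * I := by
      rw [← integral_mul_const]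
      linarith
    exact nonneg_of_mul_nonneg_left this hIpos
  refine le_of_forall_pos_le_add fun ε hε => ?_
  set m := ν.real Set.univ with hm
  have hm0 : 0 ≤ m := measureReal_nonneg
  -- The `+ 1` covers a measure of mass zero; the accumulated error `m * (ε / (m + 1))` is at most
  -- `ε`.
  have h := key (ε / (m + 1)) (by positivity)
  rw [integral_add hHint (integrable_const _), integral_const, smul_eq_mul, ← hm] at h
  have : m * (ε / (m + 1)) ≤ ε := by
    rw [mul_div_assoc', div_le_iff₀ (by positivity)]
    nlinarith
  linarith

/-! ### Monotonicity along a path of dispersion matrices -/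

theorem hessian_apply {n : ℕ} {f : Vec n → ℝ} (hf : ContDiff ℝ 2 f) (x : Vec n) (i j : Fin n) :
    hessian f x i j =
      fderiv ℝ (fderiv ℝ f) x (EuclideanSpace.single i 1) (EuclideanSpace.single j 1) := by
  have hd : DifferentiableAt ℝ (fderiv ℝ f) x :=
    (hf.fderiv_right (m := 1) (by norm_num)).differentiable (by norm_num) x
  set L := ContinuousLinearMap.apply ℝ ℝ (EuclideanSpace.single j (1 : ℝ)) with hL
  have hp : partialDeriv j f = L ∘ fderiv ℝ f := rfl
  have h := L.hasFDerivAt.comp x hd.hasFDerivAt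
  rw [hessian, Matrix.of_apply, partialDeriv, hp, h.fderiv]
  rfl

theorem vec_eq_sum_single {n : ℕ} (v : Vec n) : v = ∑ i, v i • EuclideanSpace.single i (1 : ℝ) := by
  ext j
  simp [Finset.sum_apply, Pi.single_apply]

theorem fderiv_fderiv_apply_eq_sum {n : ℕ} {f : Vec n → ℝ} (hf : ContDiff ℝ 2 f) (x v w : Vec n) :
    fderiv ℝ (fderiv ℝ f) x v w = ∑ a, ∑ b, hessian f x a b * (v a * w b) := by
  conv_lhs => rw [vec_eq_sum_single v, vec_eq_sum_single w]
  simp only [map_sum, map_smul, hessian_apply hf, sum_apply, smul_apply, smul_eq_mul,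
    Finset.mul_sum]
  rw [Finset.sum_comm]
  refine Finset.sum_congr rfl fun a _ => Finset.sum_congr rfl fun b _ => ?_
  ring

/-- The diagonal path `√((1 - l) κ + l (1 - κ))` from `√κ` to `√(1 - κ)`. -/
noncomputable def diagPath (κ l : ℝ) : ℝ := √((1 - l) * κ + l * (1 - κ))

theorem continuous_diagPath (κ : ℝ) : Continuous (diagPath κ) := by
  unfold diagPath
  fun_prop

/-- Since `κ` and `1 - κ` cannot both vanish, the square root is smooth inside the interval; at an
endpoint it may fail to be differentiable. -/
theorem diagPath_arg_pos {κ l : ℝ} (h0 : 0 ≤ κ) (h1 : κ ≤ 1) (hl0 : 0 < l) (hl1 : l < 1) :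
    0 < (1 - l) * κ + l * (1 - κ) := by
  rcases h0.eq_or_lt with rfl | h
  · simpa using hl0
  · have := mul_pos (sub_pos.2 hl1) h
    have := mul_nonneg hl0.le (sub_nonneg.2 h1)
    linarith

theorem hasDerivAt_diagPath {κ l : ℝ} (h0 : 0 ≤ κ) (h1 : κ ≤ 1) (hl0 : 0 < l) (hl1 : l < 1) :
    HasDerivAt (diagPath κ) ((1 - 2 * κ) / (2 * diagPath κ l)) l := by
  have h : HasDerivAt (fun l : ℝ => (1 - l) * κ + l * (1 - κ)) (1 - 2 * κ) l := by
    refine ((((hasDerivAt_id l).const_sub 1).mul_const κ).add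
      ((hasDerivAt_id l).mul_const (1 - κ))).congr_deriv ?_
    ring
  exact h.sqrt (diagPath_arg_pos h0 h1 hl0 hl1).ne'

theorem diagPath_ne_zero {κ l : ℝ} (h0 : 0 ≤ κ) (h1 : κ ≤ 1) (hl0 : 0 < l) (hl1 : l < 1) :
    diagPath κ l ≠ 0 :=
  (Real.sqrt_pos.2 (diagPath_arg_pos h0 h1 hl0 hl1)).ne'

/-- The affine map `x ↦ μ + A diag(d) x`. -/
noncomputable def scaledMap {n : ℕ} (μ : Vec n) (A : Matrix (Fin n) (Fin n) ℝ) (d : Fin n → ℝ)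
    (x : Vec n) : Vec n :=
  μ + ∑ j, (d j * x j) • matCLM A (EuclideanSpace.single j 1)

theorem scaledMap_eq {n : ℕ} (μ : Vec n) (A : Matrix (Fin n) (Fin n) ℝ) (d : Fin n → ℝ)
    (x : Vec n) : scaledMap μ A d x = μ + matCLM (A * Matrix.diagonal d) x := by
  rw [scaledMap]
  congr 1
  ext i
  have hd : ∀ j, (A * Matrix.diagonal d) i j = A i j * d j := fun j => Matrix.mul_diagonal _ _ _ _
  simp only [matCLM_apply, hd]
  simp
  refine Finset.sum_congr rfl fun j _ => ?_
  ring

theorem hasFDerivAt_scaledMap {n : ℕ} (μ : Vec n) (A : Matrix (Fin n) (Fin n) ℝ) (d : Fin n → ℝ)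
    (x : Vec n) : HasFDerivAt (scaledMap μ A d) (matCLM (A * Matrix.diagonal d)) x := by
  have : scaledMap μ A d = fun x => μ + matCLM (A * Matrix.diagonal d) x :=
    funext (scaledMap_eq μ A d)
  rw [this]
  exact (matCLM (A * Matrix.diagonal d)).hasFDerivAt.const_add μ

theorem matCLM_mul_diagonal_single {n : ℕ} (A : Matrix (Fin n) (Fin n) ℝ) (d : Fin n → ℝ)
    (j : Fin n) : matCLM (A * Matrix.diagonal d) (EuclideanSpace.single j 1) =
      d j • matCLM A (EuclideanSpace.single j 1) := by
  ext i
  have hd : ∀ j, (A * Matrix.diagonal d) i j = A i j * d j := fun j => Matrix.mul_diagonal _ _ _ _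
  simp only [matCLM_apply, hd]
  simp [matCLM_apply, mul_comm]

theorem contDiff_scaledMap {n : ℕ} (μ : Vec n) (A : Matrix (Fin n) (Fin n) ℝ) (d : Fin n → ℝ) :
    ContDiff ℝ 2 (scaledMap μ A d) := by
  have : scaledMap μ A d = fun x => μ + matCLM (A * Matrix.diagonal d) x :=
    funext (scaledMap_eq μ A d)
  rw [this]
  fun_prop

/-- The integrand is `F(x) · x`. The chain rule brings out `A * diagonal d`, so the divergence of
`F` pairs the Hessian with `A * diagonal (d * d') * Aᵀ`. -/
theorem RotationInvariant.integral_deriv_nonneg {n : ℕ} {ν : Measure (Vec n)} [IsFiniteMeasure ν]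
    (hν : RotationInvariant ν) {u : Vec n} (hu : ‖u‖ = 1) {N : ℝ} (hN0 : 0 ≤ N)
    (hN : ∀ᵐ x ∂ν, ‖x‖ ≤ N) (μ : Vec n) (A : Matrix (Fin n) (Fin n) ℝ) (d d' : Fin n → ℝ)
    {f : Vec n → ℝ} (hf : ContDiff ℝ 2 f)
    (hpos : ∀ y, 0 ≤ ∑ a, ∑ b, hessian f y a b *
      (A * Matrix.diagonal (fun j => d j * d' j) * Aᵀ) a b) :
    0 ≤ ∫ x, fderiv ℝ f (scaledMap μ A d x)
      (∑ j, (d' j * x j) • matCLM A (EuclideanSpace.single j 1)) ∂ν := by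
  set F : Fin n → Vec n → ℝ := fun j x =>
    fderiv ℝ f (scaledMap μ A d x) (d' j • matCLM A (EuclideanSpace.single j 1)) with hF
  have hf1 : ContDiff ℝ 1 (fderiv ℝ f) := hf.fderiv_right (m := 1) (by norm_num)
  have hmain := hν.integral_radial_nonneg hu hN0 hN (F := F) ?_ ?_
  · convert hmain using 3 with x
    simp only [hF, map_sum, map_smul, smul_eq_mul]
    refine Finset.sum_congr rfl fun j _ => ?_
    ring
  · intro j
    exact (hf1.comp ((contDiff_scaledMap μ A d).of_le (by norm_num))).clm_apply contDiff_const
  · intro x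
    have hFd : ∀ j, fderiv ℝ (F j) x (EuclideanSpace.single j 1) =
        (d j * d' j) * ∑ a, ∑ b, hessian f (scaledMap μ A d x) a b * (A a j * A b j) := by
      intro j
      have h1 : HasFDerivAt (fun x => fderiv ℝ f (scaledMap μ A d x))
          ((fderiv ℝ (fderiv ℝ f) (scaledMap μ A d x)).comp (matCLM (A * Matrix.diagonal d))) x :=
        (hf1.differentiable (by norm_num) _).hasFDerivAt.comp x (hasFDerivAt_scaledMap μ A d x)
      have h2 : HasFDerivAt (F j) _ x :=
        (ContinuousLinearMap.apply ℝ ℝ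
          (d' j • matCLM A (EuclideanSpace.single j 1))).hasFDerivAt.comp x h1
      rw [h2.fderiv]
      have hA : ∀ a, matCLM A (EuclideanSpace.single j 1) a = A a j := fun a => by
        simp [matCLM_apply]
      simp only [ContinuousLinearMap.comp_apply, ContinuousLinearMap.apply_apply,
        matCLM_mul_diagonal_single, map_smul, smul_apply, smul_eq_mul,
        fderiv_fderiv_apply_eq_sum hf, hA]
      ring
    have h := hpos (scaledMap μ A d x)
    simp_rw [hFd]
    convert h using 1
    simp only [Matrix.mul_apply (N := Aᵀ), Matrix.mul_diagonal, Matrix.transpose_apply,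
      Finset.mul_sum]
    rw [Finset.sum_comm]
    refine Finset.sum_congr rfl fun a _ => ?_
    rw [Finset.sum_comm]
    refine Finset.sum_congr rfl fun b _ => Finset.sum_congr rfl fun j _ => ?_
    ring

/-- Monotonicity of the expectation under a boundedly supported rotation invariant measure. -/
theorem RotationInvariant.integral_scaledMap_le {n : ℕ} {ν : Measure (Vec n)} [IsFiniteMeasure ν]
    (hν : RotationInvariant ν) {u : Vec n} (hu : ‖u‖ = 1) {N : ℝ} (hN0 : 0 ≤ N)
    (hN : ∀ᵐ x ∂ν, ‖x‖ ≤ N) (μ : Vec n) (A : Matrix (Fin n) (Fin n) ℝ) {κ : Fin n → ℝ}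
    (hκ0 : ∀ i, 0 ≤ κ i) (hκ1 : ∀ i, κ i ≤ 1) {f : Vec n → ℝ} (hf : ContDiff ℝ 2 f)
    (hpos : ∀ y, 0 ≤ ∑ a, ∑ b, hessian f y a b *
      (A * Matrix.diagonal (fun j => 1 - 2 * κ j) * Aᵀ) a b) :
    ∫ x, f (scaledMap μ A (fun j => diagPath (κ j) 0) x) ∂ν ≤
      ∫ x, f (scaledMap μ A (fun j => diagPath (κ j) 1) x) ∂ν := by
  have hres : ν.restrict (Metric.closedBall 0 N) = ν := by
    refine Measure.restrict_eq_self_of_ae_mem ?_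
    filter_upwards [hN] with x hx
    exact mem_closedBall_zero_iff.2 hx
  have hdc := fun i => continuous_diagPath (κ i)
  set g : ℝ → Vec n → ℝ := fun l x => f (scaledMap μ A (fun j => diagPath (κ j) l) x) with hg
  have hpath : Continuous fun z : ℝ × Vec n =>
      scaledMap μ A (fun j => diagPath (κ j) z.1) z.2 := by
    unfold scaledMap
    refine continuous_const.add (continuous_finsetSum _ fun j _ => ?_)
    exact (((hdc j).comp continuous_fst).mul (by fun_prop)).smul continuous_const
  have hgc : Continuous (Function.uncurry g) := hf.continuous.comp hpath
  have hgcl : ∀ l, Continuous (g l) := fun l =>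
    hf.continuous.comp (contDiff_scaledMap μ A _).continuous
  have hcont : Continuous fun l => ∫ x, g l x ∂ν := by
    have := continuous_parametric_integral_of_continuous (μ := ν) hgc
      (isCompact_closedBall (0 : Vec n) N)
    rwa [hres] at this
  set d' : ℝ → Fin n → ℝ := fun l j => (1 - 2 * κ j) / (2 * diagPath (κ j) l) with hd'
  set g' : ℝ → Vec n → ℝ := fun l x => fderiv ℝ f (scaledMap μ A (fun j => diagPath (κ j) l) x)
      (∑ j, (d' l j * x j) • matCLM A (EuclideanSpace.single j 1)) with hg'
  have hderiv : ∀ l ∈ Set.Ioo (0 : ℝ) 1, ∀ x, HasDerivAt (fun l => g l x) (g' l x) l := by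
    intro l hl x
    have h1 : HasDerivAt (fun l => scaledMap μ A (fun j => diagPath (κ j) l) x)
        (∑ j, (d' l j * x j) • matCLM A (EuclideanSpace.single j 1)) l := by
      refine HasDerivAt.const_add μ (HasDerivAt.fun_sum fun j _ => ?_)
      exact ((hasDerivAt_diagPath (hκ0 j) (hκ1 j) hl.1 hl.2).mul_const _).smul_const _
    exact (hf.differentiable (by norm_num) _).hasFDerivAt.comp_hasDerivAt l h1
  have hg'c : ContinuousOn (Function.uncurry g') (Set.Ioo (0 : ℝ) 1 ×ˢ Set.univ) := by
    have hd'c : ∀ j, ContinuousOn (fun z : ℝ × Vec n => d' z.1 j)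
        (Set.Ioo (0 : ℝ) 1 ×ˢ Set.univ) := fun j => by
      refine ContinuousOn.div continuousOn_const (by fun_prop) fun z hz => ?_
      exact mul_ne_zero two_ne_zero (diagPath_ne_zero (hκ0 j) (hκ1 j) hz.1.1 hz.1.2)
    have h1 : Continuous fun z : ℝ × Vec n =>
        fderiv ℝ f (scaledMap μ A (fun j => diagPath (κ j) z.1) z.2) :=
      (hf.continuous_fderiv (by norm_num)).comp hpath
    refine h1.continuousOn.clm_apply (continuousOn_finsetSum _ fun j _ => ?_)
    exact ((hd'c j).mul (by fun_prop)).smul continuousOn_const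
  have hD : ∀ l ∈ Set.Ioo (0 : ℝ) 1,
      HasDerivAt (fun l => ∫ x, g l x ∂ν) (∫ x, g' l x ∂ν) l := by
    intro l hl
    -- A compact neighbourhood of `l` away from 0 and 1, where `d'` may blow up; it supplies a
    -- uniform bound on the derivative.
    set s := Set.Icc (l / 2) ((1 + l) / 2) with hs
    have hsub : s ⊆ Set.Ioo (0 : ℝ) 1 := fun t ht =>
      ⟨by linarith [ht.1, hl.1], by linarith [ht.2, hl.2]⟩
    have hsn : s ∈ nhds l := Icc_mem_nhds (by linarith [hl.1]) (by linarith [hl.2])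
    obtain ⟨C, hC⟩ := (isCompact_Icc.prod (isCompact_closedBall (0 : Vec n) N)).exists_bound_of_continuousOn
      (hg'c.mono (Set.prod_mono hsub (Set.subset_univ _)))
    have hint : Integrable (g l) ν := by
      have := (hgcl l).continuousOn.integrableOn_compact (μ := ν)
        (isCompact_closedBall (0 : Vec n) N)
      rwa [IntegrableOn, hres] at this
    have hg'cl : Continuous (g' l) := by
      rw [← continuousOn_univ]
      exact hg'c.comp (f := fun x => (l, x)) (by fun_prop) fun x _ => ⟨hl, Set.mem_univ x⟩
    refine (hasDerivAt_integral_of_dominated_loc_of_deriv_le (bound := fun _ => C) hsn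
      (Filter.Eventually.of_forall fun t => (hgcl t).aestronglyMeasurable) hint
      hg'cl.aestronglyMeasurable ?_ (integrable_const C)
      (Filter.Eventually.of_forall fun x t ht => hderiv t (hsub ht) x)).2
    filter_upwards [hN] with x hx t ht
    exact hC (t, x) ⟨ht, mem_closedBall_zero_iff.2 hx⟩
  have hmono : MonotoneOn (fun l => ∫ x, g l x ∂ν) (Set.Icc 0 1) := by
    refine monotoneOn_of_deriv_nonneg (convex_Icc 0 1) hcont.continuousOn ?_ ?_
    · rw [interior_Icc]
      exact fun l hl => (hD l hl).differentiableAt.differentiableWithinAt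
    · rw [interior_Icc]
      intro l hl
      rw [(hD l hl).deriv]
      refine hν.integral_deriv_nonneg hu hN0 hN μ A _ _ hf fun y => ?_
      -- Half the derivative of the squared path, which is affine in `l`: hence the same matrix
      -- direction for every `l`.
      have hdd : (fun j => diagPath (κ j) l * d' l j) = fun j => (1 / 2) * (1 - 2 * κ j) := by
        funext j
        have := diagPath_ne_zero (hκ0 j) (hκ1 j) hl.1 hl.2
        simp only [hd']
        field_simp
      have hdm : Matrix.diagonal (fun j => (1 / 2) * (1 - 2 * κ j)) =
          (1 / 2 : ℝ) • Matrix.diagonal (fun j => 1 - 2 * κ j) := by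
        rw [← Matrix.diagonal_smul]
        rfl
      rw [hdd, hdm, Matrix.mul_smul, Matrix.smul_mul]
      simp only [Matrix.smul_apply, smul_eq_mul, mul_left_comm _ (1 / 2 : ℝ), ← Finset.mul_sum]
      exact mul_nonneg (by norm_num) (hpos y)
  exact hmono (by simp) (by simp) zero_le_one

theorem factor_of_diagPath {n : ℕ} (A : Matrix (Fin n) (Fin n) ℝ) {d κ : Fin n → ℝ}
    (hd : ∀ i, d i * d i = κ i) :
    A * Matrix.diagonal κ * Aᵀ = A * Matrix.diagonal d * (A * Matrix.diagonal d)ᵀ := by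
  rw [Matrix.transpose_mul, Matrix.diagonal_transpose, ← Matrix.mul_assoc,
    Matrix.mul_assoc A (Matrix.diagonal d), Matrix.diagonal_mul_diagonal]
  simp only [hd]

/-- Elliptical laws with a common generator and location are ordered if the difference of the
dispersion matrices has nonnegative products with all admissible Hessians. -/
theorem hessianLE_of_forall_sum_nonneg {Ω Ω' : Type*} [MeasurableSpace Ω] [MeasurableSpace Ω']
    {P : Measure Ω} [IsProbabilityMeasure P] {Q : Measure Ω'} [IsProbabilityMeasure Q]
    {n : ℕ} {X : Ω → Vec n} {Y : Ω' → Vec n} {μ : Vec n} {S T : Matrix (Fin n) (Fin n) ℝ}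
    {φ : ℝ → ℝ} (hX : IsElliptical P X μ S φ) (hY : IsElliptical Q Y μ T φ)
    {C : Set (Matrix (Fin n) (Fin n) ℝ)}
    (hC : ∀ M ∈ C, 0 ≤ ∑ a, ∑ b, M a b * (T - S) a b) : HessianLE C P X Q Y := by
  intro f hf hfC hfX hfY
  -- In dimension zero there is no unit vector, but both random vectors are constant.
  rcases Nat.eq_zero_or_pos n with rfl | hn
  · have h1 : ∀ ω, X ω = 0 := fun ω => Subsingleton.elim _ _
    have h2 : ∀ ω, Y ω = 0 := fun ω => Subsingleton.elim _ _
    simp [h1, h2]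
  obtain ⟨ν, _, hν⟩ := hX.generator
  have hrot := rotationInvariant_of_charFun hν
  obtain ⟨A, κ, hκ0, hκ1, hS, hT⟩ := exists_simultaneous_diagonal hX.posSemidef hY.posSemidef
  have hu : ‖(EuclideanSpace.single ⟨0, hn⟩ 1 : Vec n)‖ = 1 := by simp
  have hd0 : ∀ i, diagPath (κ i) 0 * diagPath (κ i) 0 = κ i := fun i => by
    simp [diagPath, hκ0 i]
  have hd1 : ∀ i, diagPath (κ i) 1 * diagPath (κ i) 1 = 1 - κ i := fun i => by
    simp [diagPath, hκ1 i]
  have hXν := hX.map_eq hν (hS.trans (factor_of_diagPath A hd0))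
  have hYν := hY.map_eq hν (hT.trans (factor_of_diagPath A hd1))
  simp_rw [← scaledMap_eq] at hXν hYν
  have hTS : T - S = A * Matrix.diagonal (fun j => 1 - 2 * κ j) * Aᵀ := by
    have : Matrix.diagonal (fun j => 1 - 2 * κ j) =
        Matrix.diagonal (fun i => 1 - κ i) - Matrix.diagonal κ := by
      rw [Matrix.diagonal_sub]
      congr 1
      funext j
      ring
    rw [this, Matrix.mul_sub, Matrix.sub_mul, ← hS, ← hT]
  have hpos : ∀ y, 0 ≤ ∑ a, ∑ b, hessian f y a b *
      (A * Matrix.diagonal (fun j => 1 - 2 * κ j) * Aᵀ) a b := fun y => by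
    rw [← hTS]
    exact hC _ (hfC y)
  have hsm : ∀ d, AEMeasurable (scaledMap μ A d) ν := fun d =>
    (contDiff_scaledMap μ A d).continuous.measurable.aemeasurable
  have hfs : ∀ m : Measure (Vec n), AEStronglyMeasurable f m := fun m =>
    hf.continuous.aestronglyMeasurable
  have hIX := (integrable_map_measure (hfs _) hX.aemeasurable).2 hfX
  have hIY := (integrable_map_measure (hfs _) hY.aemeasurable).2 hfY
  rw [hXν, integrable_map_measure (hfs _) (hsm _)] at hIX
  rw [hYν, integrable_map_measure (hfs _) (hsm _)] at hIY
  rw [← integral_map hX.aemeasurable (hfs _), ← integral_map hY.aemeasurable (hfs _), hXν, hYν,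
    integral_map (hsm _) (hfs _), integral_map (hsm _) (hfs _)]
  -- Balls are rotation invariant, so the inequality can be proved on each ball and passed to the
  -- limit using integrability at the two endpoints alone.
  have hlim : ∀ g : Vec n → ℝ, Integrable g ν → Filter.Tendsto
      (fun N : ℕ => ∫ x in Metric.closedBall 0 (N : ℝ), g x ∂ν) Filter.atTop
      (nhds (∫ x, g x ∂ν)) := fun g hg => by
    have := tendsto_setIntegral_of_monotone (μ := ν) (f := g)
      (s := fun N : ℕ => Metric.closedBall (0 : Vec n) (N : ℝ))
      (fun N => measurableSet_closedBall)
      (fun N M h => Metric.closedBall_subset_closedBall (by exact_mod_cast h)) hg.integrableOn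
    rwa [Metric.iUnion_closedBall_nat, setIntegral_univ] at this
  refine le_of_tendsto_of_tendsto' (hlim _ hIX) (hlim _ hIY) fun N => ?_
  refine (hrot.restrict_closedBall N).integral_scaledMap_le hu N.cast_nonneg ?_ μ A hκ0 hκ1 hf hpos
  filter_upwards [ae_restrict_mem measurableSet_closedBall] with x hx
  exact mem_closedBall_zero_iff.1 hx

/-! ### Quadratic test functions and their expectations -/

/-- The quadratic form of a matrix centred at `μ`, halved. -/
noncomputable def halfQuadratic {n : ℕ} (M : Matrix (Fin n) (Fin n) ℝ) (μ y : Vec n) : ℝ :=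
  (1 / 2) * inner ℝ (y - μ) (matCLM M (y - μ))

theorem contDiff_halfQuadratic {n : ℕ} (M : Matrix (Fin n) (Fin n) ℝ) (μ : Vec n) :
    ContDiff ℝ 2 (halfQuadratic M μ) := by
  have h : ContDiff ℝ 2 fun y : Vec n => matCLM M (y - μ) := by fun_prop
  have h' : ContDiff ℝ 2 fun y : Vec n => y - μ := by fun_prop
  exact contDiff_const.mul (h'.inner ℝ h)

theorem hasFDerivAt_inner_sub_clm {E : Type*} [NormedAddCommGroup E] [InnerProductSpace ℝ E]
    (L : E →L[ℝ] E) (c y : E) : HasFDerivAt (fun y => inner ℝ (y - c) (L (y - c)))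
      (innerSL ℝ (L (y - c)) + (innerSL ℝ (y - c)).comp L) y := by
  have h1 : HasFDerivAt (fun y : E => y - c) (ContinuousLinearMap.id ℝ E) y :=
    (hasFDerivAt_id y).sub_const c
  have h2 : HasFDerivAt (fun y : E => L (y - c)) L y := L.hasFDerivAt.comp y h1
  refine (h1.inner ℝ h2).congr_fderiv ?_
  ext v
  simp [fderivInnerCLM_apply, real_inner_comm v, add_comm, inner_sub_left, inner_sub_right]

theorem hasFDerivAt_inner_clm_sub {E : Type*} [NormedAddCommGroup E] [InnerProductSpace ℝ E]
    (L : E →L[ℝ] E) (e c y : E) : HasFDerivAt (fun y => inner ℝ e (L (y - c)))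
      ((innerSL ℝ e).comp L) y := by
  have h1 : HasFDerivAt (fun y : E => y - c) (ContinuousLinearMap.id ℝ E) y :=
    (hasFDerivAt_id y).sub_const c
  exact ((innerSL ℝ e).comp L).hasFDerivAt.comp y h1

theorem partialDeriv_halfQuadratic {n : ℕ} {M : Matrix (Fin n) (Fin n) ℝ} (hM : Mᵀ = M)
    (μ y : Vec n) (j : Fin n) : partialDeriv j (halfQuadratic M μ) y =
      inner ℝ (EuclideanSpace.single j 1) (matCLM M (y - μ)) := by
  have h3 : HasFDerivAt (halfQuadratic M μ) _ y :=
    (hasFDerivAt_inner_sub_clm (matCLM M) μ y).const_mul (1 / 2)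
  have h4 : inner ℝ (y - μ) (matCLM M (EuclideanSpace.single j 1)) =
      inner ℝ (EuclideanSpace.single j 1) (matCLM M (y - μ)) := by
    rw [real_inner_comm, inner_matCLM_left, hM]
  rw [partialDeriv, h3.fderiv]
  simp only [smul_apply, add_apply, ContinuousLinearMap.comp_apply, innerSL_apply_apply,
    smul_eq_mul]
  rw [h4, real_inner_comm (EuclideanSpace.single j 1)]
  ring

theorem hessian_halfQuadratic {n : ℕ} {M : Matrix (Fin n) (Fin n) ℝ} (hM : Mᵀ = M) (μ x : Vec n) :
    hessian (halfQuadratic M μ) x = M := by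
  ext i j
  rw [hessian, Matrix.of_apply, funext fun y => partialDeriv_halfQuadratic hM μ y j, partialDeriv,
    (hasFDerivAt_inner_clm_sub (matCLM M) (EuclideanSpace.single j 1) μ x).fderiv]
  rw [ContinuousLinearMap.comp_apply, innerSL_apply_apply, EuclideanSpace.inner_single_left,
    matCLM_apply]
  have : M j i = M i j := by rw [← Matrix.transpose_apply M, hM]
  simp [this]

theorem hessian_clm {n : ℕ} (L : Vec n →L[ℝ] ℝ) (x : Vec n) : hessian L x = 0 := by
  ext i j
  have : partialDeriv j L = fun _ => L (EuclideanSpace.single j 1) := by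
    funext y
    rw [partialDeriv, L.fderiv]
  rw [hessian, Matrix.of_apply, this, partialDeriv]
  simp

theorem matCLM_apply_eq_inner {n : ℕ} (A : Matrix (Fin n) (Fin n) ℝ) (x : Vec n) (i : Fin n) :
    matCLM A x i = inner ℝ (matCLM Aᵀ (EuclideanSpace.single i 1)) x := by
  rw [inner_matCLM_left, Matrix.transpose_transpose, EuclideanSpace.inner_single_left]
  simp

theorem inner_matCLM_transpose_single {n : ℕ} (A : Matrix (Fin n) (Fin n) ℝ) (i j : Fin n) :
    inner ℝ (matCLM Aᵀ (EuclideanSpace.single i 1)) (matCLM Aᵀ (EuclideanSpace.single j 1)) =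
      (A * Aᵀ) i j := by
  rw [← matCLM_apply_eq_inner, matCLM_apply, Matrix.mul_apply]
  simp [matCLM_apply]

section Moments

variable {Ω : Type*} [MeasurableSpace Ω] {n : ℕ} {P : Measure Ω} [IsProbabilityMeasure P]
  {X : Ω → Vec n} {μ : Vec n} {S A : Matrix (Fin n) (Fin n) ℝ} {φ : ℝ → ℝ}
  {ν : Measure (Vec n)} [IsProbabilityMeasure ν]

theorem memLp_apply {P : Measure Ω} (hX2 : MemLp X 2 P) (i : Fin n) : MemLp (fun ω => X ω i) 2 P :=
  (EuclideanSpace.proj (𝕜 := ℝ) i).comp_memLp' hX2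

theorem IsElliptical.integral_comp (hX : IsElliptical P X μ S φ)
    (hν : ∀ t : Vec n, charFun ν t = ((φ (t.ofLp ⬝ᵥ t.ofLp) : ℝ) : ℂ)) (hA : S = A * Aᵀ)
    {f : Vec n → ℝ} (hf : Continuous f) :
    ∫ ω, f (X ω) ∂P = ∫ x, f (μ + matCLM A x) ∂ν := by
  rw [← integral_map hX.aemeasurable hf.aestronglyMeasurable, hX.map_eq hν hA,
    integral_map (by fun_prop) hf.aestronglyMeasurable]

theorem IsElliptical.integrable_comp_iff (hX : IsElliptical P X μ S φ)
    (hν : ∀ t : Vec n, charFun ν t = ((φ (t.ofLp ⬝ᵥ t.ofLp) : ℝ) : ℂ)) (hA : S = A * Aᵀ)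
    {f : Vec n → ℝ} (hf : Continuous f) :
    Integrable (fun ω => f (X ω)) P ↔ Integrable (fun x => f (μ + matCLM A x)) ν := by
  have h1 := integrable_map_measure (hf.aestronglyMeasurable (μ := P.map X)) hX.aemeasurable
  rw [hX.map_eq hν hA, integrable_map_measure hf.aestronglyMeasurable (by fun_prop)] at h1
  exact h1.symm

theorem IsElliptical.integral_apply (hX : IsElliptical P X μ S φ)
    (hν : ∀ t : Vec n, charFun ν t = ((φ (t.ofLp ⬝ᵥ t.ofLp) : ℝ) : ℂ)) (hA : S = A * Aᵀ)
    (hX2 : MemLp X 2 P) (i : Fin n) : ∫ ω, X ω i ∂P = μ i := by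
  have hc : Continuous fun y : Vec n => y i := by fun_prop
  have hint := (memLp_apply hX2 i).integrable (by norm_num)
  rw [hX.integrable_comp_iff hν hA hc] at hint
  have hint' : Integrable (fun x => matCLM A x i) ν := by
    refine (hint.sub (integrable_const (μ i))).congr (Filter.Eventually.of_forall fun x => ?_)
    simp
  rw [hX.integral_comp hν hA hc]
  simp only [PiLp.add_apply]
  rw [integral_add (integrable_const _) hint']
  simp_rw [matCLM_apply_eq_inner]
  rw [(rotationInvariant_of_charFun hν).integral_inner_eq_zero]
  simp

/-- A nonzero dispersion makes some coordinate of `A x` a nonzero linear form. Its second moment is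
finite because that of `X` is, and rotation invariance carries this to every direction. -/
theorem IsElliptical.integrable_inner_sq (hX : IsElliptical P X μ S φ)
    (hν : ∀ t : Vec n, charFun ν t = ((φ (t.ofLp ⬝ᵥ t.ofLp) : ℝ) : ℂ)) (hA : S = A * Aᵀ)
    (hX2 : MemLp X 2 P) (hS : S ≠ 0) (b : Vec n) : Integrable (fun x => (inner ℝ b x) ^ 2) ν := by
  obtain ⟨i, hi⟩ : ∃ i, matCLM Aᵀ (EuclideanSpace.single i 1) ≠ 0 := by
    by_contra! h
    refine hS ?_
    ext i j
    rw [hA, ← inner_matCLM_transpose_single, h i, inner_zero_left, Matrix.zero_apply]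
  refine (rotationInvariant_of_charFun hν).integrable_inner_sq hi ?_ b
  have h := ((memLp_apply hX2 i).sub (memLp_const (μ i))).integrable_sq
  have hc : Continuous fun y : Vec n => (y i - μ i) ^ 2 := by fun_prop
  refine ((hX.integrable_comp_iff hν hA hc).1 h).congr (Filter.Eventually.of_forall fun x => ?_)
  simp [← matCLM_apply_eq_inner]

theorem halfQuadratic_add_matCLM (M : Matrix (Fin n) (Fin n) ℝ) (x : Vec n) :
    halfQuadratic M μ (μ + matCLM A x) = ∑ a, ∑ b, (1 / 2 * M a b) *
      (inner ℝ (matCLM Aᵀ (EuclideanSpace.single a 1)) x *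
        inner ℝ (matCLM Aᵀ (EuclideanSpace.single b 1)) x) := by
  rw [halfQuadratic, add_sub_cancel_left, Matrix.inner_toEuclideanCLM]
  simp only [dotProduct, Matrix.mulVec, Finset.mul_sum, ← matCLM_apply_eq_inner]
  refine Finset.sum_congr rfl fun a _ => Finset.sum_congr rfl fun b _ => ?_
  ring

theorem IsElliptical.integrable_halfQuadratic (hX : IsElliptical P X μ S φ)
    (hν : ∀ t : Vec n, charFun ν t = ((φ (t.ofLp ⬝ᵥ t.ofLp) : ℝ) : ℂ)) (hA : S = A * Aᵀ)
    (hint : ∀ b : Vec n, Integrable (fun x => (inner ℝ b x) ^ 2) ν)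
    (M : Matrix (Fin n) (Fin n) ℝ) : Integrable (fun ω => halfQuadratic M μ (X ω)) P := by
  rw [hX.integrable_comp_iff hν hA (contDiff_halfQuadratic M μ).continuous]
  simp_rw [halfQuadratic_add_matCLM]
  exact integrable_finsetSum _ fun a _ => integrable_finsetSum _ fun b _ =>
    (integrable_inner_mul_inner hint _ _).const_mul _

theorem IsElliptical.integral_halfQuadratic (hX : IsElliptical P X μ S φ)
    (hν : ∀ t : Vec n, charFun ν t = ((φ (t.ofLp ⬝ᵥ t.ofLp) : ℝ) : ℂ)) (hA : S = A * Aᵀ)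
    (hint : ∀ b : Vec n, Integrable (fun x => (inner ℝ b x) ^ 2) ν) {u : Vec n} (hu : ‖u‖ = 1)
    (M : Matrix (Fin n) (Fin n) ℝ) : ∫ ω, halfQuadratic M μ (X ω) ∂P =
      1 / 2 * (∫ x, (inner ℝ u x) ^ 2 ∂ν) * ∑ a, ∑ b, M a b * S a b := by
  rw [hX.integral_comp hν hA (contDiff_halfQuadratic M μ).continuous]
  simp_rw [halfQuadratic_add_matCLM]
  have hI : ∀ a b, Integrable (fun x => (1 / 2 * M a b) *
      (inner ℝ (matCLM Aᵀ (EuclideanSpace.single a 1)) x *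
        inner ℝ (matCLM Aᵀ (EuclideanSpace.single b 1)) x)) ν := fun a b =>
    (integrable_inner_mul_inner hint _ _).const_mul _
  rw [integral_finsetSum _ fun a _ => integrable_finsetSum _ fun b _ => hI a b, Finset.mul_sum]
  refine Finset.sum_congr rfl fun a _ => ?_
  rw [integral_finsetSum _ fun b _ => hI a b, Finset.mul_sum]
  refine Finset.sum_congr rfl fun b _ => ?_
  rw [integral_const_mul,
    (rotationInvariant_of_charFun hν).integral_inner_mul_inner hint hu,
    inner_matCLM_transpose_single, ← hA]
  ring

end Moments

theorem exists_mul_transpose_eq {n : ℕ} {S : Matrix (Fin n) (Fin n) ℝ} (hS : S.PosSemidef) :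
    ∃ A : Matrix (Fin n) (Fin n) ℝ, S = A * Aᵀ := by
  obtain ⟨U, d, -, -, hd, hU⟩ := exists_orthogonal_diagonal hS
  exact ⟨_, hU.trans (factor_of_diagPath U fun i => Real.mul_self_sqrt (hd i))⟩

/-! ### Necessary conditions -/

section Necessity

variable {Ω Ω' : Type*} [MeasurableSpace Ω] [MeasurableSpace Ω']
  {P : Measure Ω} [IsProbabilityMeasure P] {Q : Measure Ω'} [IsProbabilityMeasure Q]
  {n : ℕ} {X : Ω → Vec n} {Y : Ω' → Vec n} {S T : Matrix (Fin n) (Fin n) ℝ}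
  {φ : ℝ → ℝ} {C : Set (Matrix (Fin n) (Fin n) ℝ)}

theorem HessianLE.location_eq {μ μ' : Vec n} (hX : IsElliptical P X μ S φ)
    (hY : IsElliptical Q Y μ' T φ) (hX2 : MemLp X 2 P) (hY2 : MemLp Y 2 Q) (h0 : 0 ∈ C)
    (h : HessianLE C P X Q Y) : μ = μ' := by
  obtain ⟨ν, _, hν⟩ := hX.generator
  obtain ⟨A, hA⟩ := exists_mul_transpose_eq hX.posSemidef
  obtain ⟨B, hB⟩ := exists_mul_transpose_eq hY.posSemidef
  have hiX : ∀ i, Integrable (fun ω => X ω i) P := fun i =>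
    (memLp_apply hX2 i).integrable (by norm_num)
  have hiY : ∀ i, Integrable (fun ω => Y ω i) Q := fun i =>
    (memLp_apply hY2 i).integrable (by norm_num)
  ext i
  have h1 := h (EuclideanSpace.proj (𝕜 := ℝ) i) (ContinuousLinearMap.contDiff _)
    (fun x => by rwa [hessian_clm]) (hiX i) (hiY i)
  have h2 := h (-EuclideanSpace.proj (𝕜 := ℝ) i : Vec n →L[ℝ] ℝ) (ContinuousLinearMap.contDiff _)
    (fun x => by rwa [hessian_clm]) (hiX i).neg (hiY i).neg
  simp only [neg_apply, integral_neg] at h2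
  change ∫ ω, X ω i ∂P ≤ ∫ ω, Y ω i ∂Q at h1
  change -∫ ω, X ω i ∂P ≤ -∫ ω, Y ω i ∂Q at h2
  rw [hX.integral_apply hν hA hX2, hY.integral_apply hν hB hY2] at h1 h2
  linarith

theorem HessianLE.sum_nonneg {μ : Vec n} (hX : IsElliptical P X μ S φ)
    (hY : IsElliptical Q Y μ T φ) (hφ : ∃ u : ℝ, 0 ≤ u ∧ φ u ≠ 1)
    (hX2 : MemLp X 2 P) (hY2 : MemLp Y 2 Q) (h : HessianLE C P X Q Y)
    {M : Matrix (Fin n) (Fin n) ℝ} (hMC : M ∈ C) (hM : Mᵀ = M) :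
    0 ≤ ∑ a, ∑ b, M a b * (T - S) a b := by
  obtain ⟨ν, _, hν⟩ := hX.generator
  obtain ⟨A, hA⟩ := exists_mul_transpose_eq hX.posSemidef
  obtain ⟨B, hB⟩ := exists_mul_transpose_eq hY.posSemidef
  -- If both laws are degenerate, their moments say nothing about those of `ν`, but the claim is
  -- trivial. Otherwise one nonzero dispersion suffices, as `ν` is shared.
  by_cases hST : S = 0 ∧ T = 0
  · simp [hST.1, hST.2]
  have hint : ∀ b : Vec n, Integrable (fun x => (inner ℝ b x) ^ 2) ν := by
    by_cases hS : S = 0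
    · exact hY.integrable_inner_sq hν hB hY2 fun hT => hST ⟨hS, hT⟩
    · exact hX.integrable_inner_sq hν hA hX2 hS
  have hn : 0 < n := by
    refine Nat.pos_of_ne_zero fun hn => hST ?_
    subst hn
    exact ⟨Subsingleton.elim _ _, Subsingleton.elim _ _⟩
  set u : Vec n := EuclideanSpace.single ⟨0, hn⟩ 1
  have hu : ‖u‖ = 1 := by simp [u]
  -- If this variance vanished, the characteristic function of `ν` would be one everywhere; at `√v •
  -- u` it equals `φ v`, which is not one.
  have hc : 0 < ∫ x, (inner ℝ u x) ^ 2 ∂ν := by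
    refine lt_of_le_of_ne (integral_nonneg fun x => sq_nonneg _) fun h0 => ?_
    obtain ⟨v, hv, hφv⟩ := hφ
    have h1 := (rotationInvariant_of_charFun hν).charFun_eq_one hint hu h0.symm (√v • u)
    rw [hν] at h1
    have h2 : (√v • u).ofLp ⬝ᵥ (√v • u).ofLp = v := by
      simp [u, hv]
    rw [h2] at h1
    exact hφv (by exact_mod_cast h1)
  have hle := h (halfQuadratic M μ) (contDiff_halfQuadratic M μ)
    (fun x => by rwa [hessian_halfQuadratic hM]) (hX.integrable_halfQuadratic hν hA hint M)
    (hY.integrable_halfQuadratic hν hB hint M)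
  rw [hX.integral_halfQuadratic hν hA hint hu, hY.integral_halfQuadratic hν hB hint hu] at hle
  have := le_of_mul_le_mul_left hle (by positivity)
  simp only [Matrix.sub_apply, mul_sub, Finset.sum_sub_distrib]
  linarith

end Necessity

/-! ### Assembly of the two equivalences -/

theorem dotProduct_mulVec_eq_sum {n : ℕ} (M : Matrix (Fin n) (Fin n) ℝ) (x : Fin n → ℝ) :
    x ⬝ᵥ M *ᵥ x = ∑ i, ∑ j, Matrix.vecMulVec x x i j * M i j := by
  simp only [dotProduct, Matrix.mulVec, Matrix.vecMulVec_apply, Finset.mul_sum]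
  refine Finset.sum_congr rfl fun i _ => Finset.sum_congr rfl fun j _ => ?_
  ring

theorem zero_mem_copositiveCone (n : ℕ) : 0 ∈ copositiveCone n := fun x _ => by simp

end HessianOrder

theorem theorem3p11 {Ω Ω' : Type*} [MeasurableSpace Ω] [MeasurableSpace Ω']
    (P : Measure Ω) [IsProbabilityMeasure P] (Q : Measure Ω') [IsProbabilityMeasure Q]
    (n : ℕ) (X : Ω → HessianOrder.Vec n) (Y : Ω' → HessianOrder.Vec n)
    (μx μy : HessianOrder.Vec n) (Sx Sy : Matrix (Fin n) (Fin n) ℝ) (φ : ℝ → ℝ)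
    (hX : HessianOrder.IsElliptical P X μx Sx φ)
    (hY : HessianOrder.IsElliptical Q Y μy Sy φ)
    (hφ : ∃ u : ℝ, 0 ≤ u ∧ φ u ≠ 1)
    (hX2 : MemLp X 2 P) (hY2 : MemLp Y 2 Q) :
    (HessianOrder.CpLE P X Q Y ↔
      μx = μy ∧ Sy - Sx ∈ HessianOrder.copositiveCone n) ∧
    (HessianOrder.CopLE P X Q Y ↔
      μx = μy ∧ Sy - Sx ∈ HessianOrder.completelyPositiveCone n) := by
  refine ⟨⟨fun h => ?_, ?_⟩, ⟨fun h => ?_, ?_⟩⟩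
  · have hμ := h.location_eq hX hY hX2 hY2 (HessianOrder.zero_mem_completelyPositiveCone n)
    subst hμ
    refine ⟨rfl, fun x hx => ?_⟩
    rw [HessianOrder.dotProduct_mulVec_eq_sum]
    exact h.sum_nonneg hX hY hφ hX2 hY2 (HessianOrder.vecMulVec_mem_completelyPositiveCone hx)
      (Matrix.transpose_vecMulVec x x)
  · rintro ⟨rfl, hD⟩
    refine HessianOrder.hessianLE_of_forall_sum_nonneg hX hY fun M hM => ?_
    simp_rw [mul_comm (M _ _)]
    exact HessianOrder.sum_mul_nonneg_of_copositive hM hD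
  · have hμ := h.location_eq hX hY hX2 hY2 (HessianOrder.zero_mem_copositiveCone n)
    subst hμ
    -- Only symmetric `M` are Hessians of the test quadratics; they suffice because `Sy - Sx` is
    -- symmetric.
    refine ⟨rfl, HessianOrder.mem_completelyPositiveCone_of_forall_copositive ?_ fun M hM hMt =>
      h.sum_nonneg hX hY hφ hX2 hY2 hM hMt⟩
    have h1 := hX.posSemidef.1
    have h2 := hY.posSemidef.1
    rw [Matrix.IsHermitian, Matrix.conjTranspose_eq_transpose_of_trivial] at h1 h2
    rw [Matrix.transpose_sub, h1, h2]
  · rintro ⟨rfl, hD⟩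
    exact HessianOrder.hessianLE_of_forall_sum_nonneg hX hY fun M hM =>
      HessianOrder.sum_mul_nonneg_of_copositive hD hM
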